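/- Let $n=2m$ with $m\ge 1$ and $d\in\mathbb N=\{0,1,2,\dots\}$. A depth-$d$ one-dimensional brickwall circuit on modes $1,\dots,n$ is a unitary matrix $U=U^{(d)}\cdots U^{(2)}U^{(1)}$, where each step is $U^{(i)}=U^{R,(i)}U^{L,(i)}$ with $U^{L,(i)}=\bigoplus_{j=1}^{m}u^{(i)}_j$ and $U^{R,(i)}=u^{(i)}_0\oplus\big(\bigoplus_{j=1}^{m-1}u^{(i)}_{m+j}\big)\oplus u_0'^{(i)}$, for gates $u^{(i)}_1,\dots,u^{(i)}_{n-1}\in\mathrm U(2)$ and $u^{(i)}_0,u_0'^{(i)}\in\mathrm U(1)$. Let all $n$ bosonic modes start in the squeezed vacuum with squeezing parameter $s>0$ and evolve under the passive linear optical unitary given by $U$ (which fixes the vacuum and maps the creation operator $a_j^\dagger$ to $\sum_i U_{ij}a_i^\dagger$). For $0\le k\le n$, let $\rho$ be the reduced density operator of the first $k$ modes of the resulting pure state, and let $S_2(U)=-\log\operatorname{Tr}\rho^2$ be its Rényi-2 entropy. (i) (Worst-case bound) For all $n,d,k,s$ as above and every choice of the gates, $$S_2(U)\le 4d\log\cosh(2s).$$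 (ii) (Average-case bound) Let all the $2\times2$ and $1\times1$ gates be independent and Haar distributed. There is a universal constant $C$ such that, for all $n,k,s$ as above and all $d\ge2$, $S_2(U)$ is integrable and $$\mathbf E\,S_2(U)\le C\sqrt{d\log d}\,\sinh^2(2s).$$ Moreover, for every $\kappa\in\mathbb N$ there are constants $C_\kappa,K_\kappa$, depending only on $\kappa$, such that, for all $n,k,s$ as above and all $d\ge2$, $$\mathbf P\big[S_2(U)\le C_\kappa\sinh^2(2s)\sqrt{d\log d}\big]\ge 1-K_\kappa d^{-\kappa}.$$ -/

import Mathlib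

open MeasureTheory

noncomputable section

namespace LinearOptics

/-! ### Pure states of bosonic modes

A bosonic system with finite mode set `ι` is described in the Segal-Bargmann realization of Fock
space: a vector is a holomorphic function `F : (ι → ℂ) → ℂ` that is square integrable for the
Gaussian measure `π⁻ⁿ exp(-|z|²) dz`, the number state with occupations `a` is the monomial
`∏ i, z i ^ a i / √(a i)!`, the vacuum is the constant `1`, and the creation operator of mode `j`
is multiplication by `z j`. -/

/-- The Gaussian probability measure `∏ i, π⁻¹ exp(-|z i|²) dz i` on `ℂ^ι`. -/
def bargmannMeasure (ι : Type) [Fintype ι] : Measure (ι → ℂ) :=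
  Measure.pi fun _ : ι =>
    (volume : Measure ℂ).withDensity fun z =>
      ENNReal.ofReal (Real.pi⁻¹ * Real.exp (-‖z‖ ^ 2))

/-- All modes in the single-mode squeezed vacuum with squeezing parameter `s`,
`(cosh s)^(-1/2) ∑_r (tanh s)^r √(2r)! / (2^r r!) |2r⟩`, whose Bargmann function is
`(cosh s)^(-1/2) exp(tanh s · z² / 2)`. -/
def squeezedVacuum {ι : Type} [Fintype ι] (s : ℝ) : (ι → ℂ) → ℂ := fun z =>
  ∏ i, (((Real.sqrt (Real.cosh s))⁻¹ : ℝ) : ℂ) * Complex.exp ((Real.tanh s : ℂ) / 2 * z i ^ 2)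

/-- The passive linear optical (second quantized) unitary of `U` on Fock space: it fixes the vacuum
and maps the creation operator of mode `j` to `∑ i, U i j · (creation operator of mode i)`, so it
substitutes `∑ i, U i j * z i` for `z j`. -/
def passiveUnitary {ι : Type} [Fintype ι] (U : Matrix ι ι ℂ) (F : (ι → ℂ) → ℂ) : (ι → ℂ) → ℂ :=
  fun z => F (U.transpose.mulVec z)

/-- The point of `ℂ^ι` with coordinates `z` in `Γ` and `y` outside `Γ`. -/
def glue {ι : Type} [DecidableEq ι] (Γ : Finset ι)
    (z : {i // i ∈ Γ} → ℂ) (y : {i // i ∉ Γ} → ℂ) : ι → ℂ :=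
  fun i => if h : i ∈ Γ then z ⟨i, h⟩ else y ⟨i, h⟩

/-- The integral kernel `ρ(z, w)` of the reduced density operator of the modes in `Γ` for the pure
state `F`: the partial trace of `F(z, y) * conj F(w, y')` over the modes outside `Γ`. It acts by
`(ρ G)(z) = ∫ w, ρ(z, w) G(w)`. -/
def reducedDensity {ι : Type} [Fintype ι] [DecidableEq ι] (Γ : Finset ι) (F : (ι → ℂ) → ℂ)
    (z w : {i // i ∈ Γ} → ℂ) : ℂ :=
  ∫ y, F (glue Γ z y) * (starRingEnd ℂ) (F (glue Γ w y)) ∂(bargmannMeasure {i // i ∉ Γ})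

/-- `Tr ρ²` for the operator with integral kernel `ρ`. -/
def traceSq {κ : Type} [Fintype κ] (ρ : (κ → ℂ) → (κ → ℂ) → ℂ) : ℂ :=
  ∫ z, ∫ w, ρ z w * ρ w z ∂(bargmannMeasure κ) ∂(bargmannMeasure κ)

/-- The Rényi-2 entropy `S₂(U) = -log Tr ρ²` of the modes in `Γ`, where all modes start in the
squeezed vacuum with parameter `s` and evolve under the passive linear optical unitary of `U`. -/
def renyi2 {ι : Type} [Fintype ι] [DecidableEq ι] (s : ℝ) (Γ : Finset ι)
    (U : Matrix ι ι ℂ) : ℝ :=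
  -Real.log (traceSq (reducedDensity Γ (passiveUnitary U (squeezedVacuum s)))).re

/-! ### Haar measure on `U(q)` -/

instance unitaryMeasurableSpace (q : ℕ) : MeasurableSpace (Matrix.unitaryGroup (Fin q) ℂ) :=
  borel _

instance unitaryBorelSpace (q : ℕ) : BorelSpace (Matrix.unitaryGroup (Fin q) ℂ) := ⟨rfl⟩

instance unitaryCompactSpace (q : ℕ) : CompactSpace (Matrix.unitaryGroup (Fin q) ℂ) := by
  have hcl : IsClosed (Matrix.unitaryGroup (Fin q) ℂ : Set (Matrix (Fin q) (Fin q) ℂ)) :=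
    isClosed_unitary
  have hK : IsCompact (Set.univ.pi fun _ : Fin q => Set.univ.pi fun _ : Fin q =>
      Metric.closedBall (0 : ℂ) 1 : Set (Fin q → Fin q → ℂ)) :=
    isCompact_univ_pi fun _ => isCompact_univ_pi fun _ => isCompact_closedBall _ _
  refine isCompact_iff_compactSpace.mp (IsCompact.of_isClosed_subset hK hcl ?_)
  intro A hA i _ j _
  simpa using entry_norm_bound_of_unitary hA i j

/-- The Haar probability measure on `U(q)`. -/
def haarUnitary (q : ℕ) : Measure (Matrix.unitaryGroup (Fin q) ℂ) :=
  Measure.haarMeasure ⊤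

/-! ### One-dimensional brickwall circuits on `n = 2 m` modes

Mode `x + 1` is the index `x : Fin (2 * m)`. -/

/-- The gates of one brickwall step: the `m` two-mode gates of the layer `U^L`, the `m - 1` two-mode
gates of the layer `U^R`, and the one-mode gates of `U^R` on the first and on the last mode. -/
abbrev StepGates (m : ℕ) : Type :=
  (Fin m → Matrix.unitaryGroup (Fin 2) ℂ) × (Fin (m - 1) → Matrix.unitaryGroup (Fin 2) ℂ) ×
    Matrix.unitaryGroup (Fin 1) ℂ × Matrix.unitaryGroup (Fin 1) ℂ

/-- `U^L = u_1 ⊕ ⋯ ⊕ u_m`, with `2 × 2` blocks on the index pairs `{2j, 2j+1}`. -/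
def leftLayer {m : ℕ} (u : Fin m → Matrix.unitaryGroup (Fin 2) ℂ) :
    Matrix (Fin (2 * m)) (Fin (2 * m)) ℂ := fun x y =>
  if (x : ℕ) / 2 = (y : ℕ) / 2 then
    (u ⟨(x : ℕ) / 2, by omega⟩).1 ⟨(x : ℕ) % 2, by omega⟩ ⟨(y : ℕ) % 2, by omega⟩
  else 0

/-- `U^R = a ⊕ u_1 ⊕ ⋯ ⊕ u_{m-1} ⊕ b`, with the `1 × 1` blocks `a`, `b` on the first and the last
index, and `2 × 2` blocks on the index pairs `{2j+1, 2j+2}`. -/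
def rightLayer {m : ℕ} (u : Fin (m - 1) → Matrix.unitaryGroup (Fin 2) ℂ)
    (a b : Matrix.unitaryGroup (Fin 1) ℂ) : Matrix (Fin (2 * m)) (Fin (2 * m)) ℂ := fun x y =>
  if ((x : ℕ) + 1) / 2 = ((y : ℕ) + 1) / 2 then
    if hx : (x : ℕ) = 0 then a.1 0 0
    else if hx' : (x : ℕ) + 1 = 2 * m then b.1 0 0
    else (u ⟨((x : ℕ) - 1) / 2, by omega⟩).1
      ⟨((x : ℕ) + 1) % 2, by omega⟩ ⟨((y : ℕ) + 1) % 2, by omega⟩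
  else 0

/-- One brickwall step `U^R U^L`. -/
def stepMatrix {m : ℕ} (g : StepGates m) : Matrix (Fin (2 * m)) (Fin (2 * m)) ℂ :=
  rightLayer g.2.1 g.2.2.1 g.2.2.2 * leftLayer g.1

/-- The gates of a circuit of depth `d`, i.e. of `d` steps. -/
abbrev CircuitGates (m d : ℕ) : Type := Fin d → StepGates m

/-- The depth-`d` brickwall unitary `U^(d) ⋯ U^(2) U^(1)`. -/
def brickwall {m d : ℕ} (g : CircuitGates m d) : Matrix (Fin (2 * m)) (Fin (2 * m)) ℂ :=
  (List.ofFn fun i => stepMatrix (g i)).reverse.prod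

/-- The law of the gates of one step when all of them are independent and Haar distributed. -/
def haarStep (m : ℕ) : Measure (StepGates m) :=
  (Measure.pi fun _ => haarUnitary 2).prod
    ((Measure.pi fun _ => haarUnitary 2).prod ((haarUnitary 1).prod (haarUnitary 1)))

/-- The law of the gates of a random depth-`d` circuit: all gates are independent and Haar
distributed. -/
def haarCircuit (m d : ℕ) : Measure (CircuitGates m d) :=
  Measure.pi fun _ => haarStep m

/-- The subsystem of the first `k` modes. -/
def firstModes (m k : ℕ) : Finset (Fin (2 * m)) :=
  Finset.univ.filter fun x => (x : ℕ) < k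

/-- The Rényi-2 entropy of the first `k` modes for the brickwall circuit with gates `g`. -/
def entropy {m d : ℕ} (s : ℝ) (k : ℕ) (g : CircuitGates m d) : ℝ :=
  renyi2 s (firstModes m k) (brickwall g)

end LinearOptics

end

/-! The circuit enters the state only through the symmetric unitary A = U Uᵀ, since the Bargmann
function is a constant times exp(tanh s · zᵀAz / 2). Tr ρ² is the expectation of the swap of the
modes in Γ on two copies of the state. A balanced beam splitter between the copies leaves this
Gaussian invariant and turns the swap into the parity D of Γ on one copy alone
(`traceSq_reducedDensity_eq_mul`). Two Gaussian integrals remain; their squares are inverse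
determinants (`integral_gaussian_quadratic_sq`). This gives S₂ = ¼ ∑ log(1 + ¼ sinh²(2s) |1 - dᵢ|²),
where the dᵢ are the eigenvalues of the unitary (DAD)ᴴA (`renyi2_eq_sum_log`).

Up to a unitary factor, 1 - (DAD)ᴴA is the commutator [A, D]. So the rank of [A, D] bounds the
number of dᵢ ≠ 1, and its Frobenius norm is that of (1 - dᵢ) (`exists_eigenvalues_renyi2`). The map
M ↦ [M, D] satisfies the Leibniz rule, which reduces both quantities from A to U.

Worst case: the cut splits at most one gate per step, so each step adds at most 2 to the rank. Each
nontrivial eigenvalue costs at most ½ log cosh(2s) because |1 - dᵢ| ≤ 2.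

Average case: log(1 + x) ≤ x bounds S₂ by sinh²(2s) times the intensity ∑ |U x y|² over pairs x, y
on opposite sides of the cut (`renyi2_le_sum_norm_sq`). Rows within distance N of the cut contribute
at most 2N by unitarity (`sum_crossing_le`); the rest has travelled a distance at least N. A Haar
gate equidistributes intensity over its two modes, so the mean intensity performs a random walk. A
cosh weight, an exponential moment of this walk, grows by at most cosh² l per step
(`lintegral_energy_brickwall_le`). With the light cone limiting the relevant columns to 4d, the
choice N ~ √(d log d) makes the far part at most 72 / d^κ in mean
(`lintegral_farTransport_le_div_pow`). Both average bounds follow, the second by Markov's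
inequality. -/

noncomputable section

namespace LinearOptics

open Matrix

section

/-! ### Gaussian integrals for the Bargmann measure -/

/-- The standard complex Gaussian measure, one factor of `bargmannMeasure`. -/
def gaussianC : Measure ℂ :=
  (volume : Measure ℂ).withDensity fun z =>
    ENNReal.ofReal (Real.pi⁻¹ * Real.exp (-‖z‖ ^ 2))

theorem bargmannMeasure_eq_pi (ι : Type) [Fintype ι] :
    bargmannMeasure ι = Measure.pi fun _ : ι => gaussianC := rfl

theorem integral_gaussianC (f : ℂ → ℂ) :
    ∫ z, f z ∂gaussianC = ∫ z : ℂ, (Real.pi : ℂ)⁻¹ * Complex.exp (-((‖z‖ ^ 2 : ℝ) : ℂ)) * f z := by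
  unfold gaussianC
  rw [integral_withDensity_eq_integral_toReal_smul₀]
  · congr 1
    ext z
    rw [ENNReal.toReal_ofReal (by positivity), Complex.real_smul]
    push_cast
    rfl
  · exact (by fun_prop : Measurable fun z : ℂ =>
      ENNReal.ofReal (Real.pi⁻¹ * Real.exp (-‖z‖ ^ 2))).aemeasurable
  · simp

/-- In real coordinates u z + v z̄ = (u + v) x + i (u - v) y, so the integral splits into two
one-dimensional complex Gaussians. Every later Gaussian integral reduces to this one. -/
theorem integral_gaussianC_exp {μ : ℂ} (hμ : μ.re < 1) (u v : ℂ) :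
    ∫ z, Complex.exp (μ * ((‖z‖ ^ 2 : ℝ) : ℂ) + u * z + v * (starRingEnd ℂ) z) ∂gaussianC
      = (1 - μ)⁻¹ * Complex.exp (u * v / (1 - μ)) := by
  have hre : (μ - 1).re < 0 := by simpa using hμ
  have hne : μ - 1 ≠ 0 := by
    intro h; rw [h] at hre; simp at hre
  have hne' : 1 - μ ≠ 0 := by
    intro h; apply hne; linear_combination -h
  rw [integral_gaussianC,
    ← Complex.volume_preserving_equiv_real_prod.symm.integral_comp
      Complex.measurableEquivRealProd.symm.measurableEmbedding]
  have key : ∀ p : ℝ × ℝ, (Real.pi : ℂ)⁻¹ *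
      Complex.exp (-((‖Complex.measurableEquivRealProd.symm p‖ ^ 2 : ℝ) : ℂ)) *
      Complex.exp (μ * ((‖Complex.measurableEquivRealProd.symm p‖ ^ 2 : ℝ) : ℂ)
        + u * Complex.measurableEquivRealProd.symm p
        + v * (starRingEnd ℂ) (Complex.measurableEquivRealProd.symm p))
      = ((Real.pi : ℂ)⁻¹ * Complex.exp ((μ - 1) * (p.1 : ℂ) ^ 2 + (u + v) * p.1 + 0)) *
        Complex.exp ((μ - 1) * (p.2 : ℂ) ^ 2 + (Complex.I * (u - v)) * p.2 + 0) := by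
    rintro ⟨x, y⟩
    have h1 : Complex.measurableEquivRealProd.symm (x, y) = x + y * Complex.I := by
      apply Complex.ext <;> simp [Complex.measurableEquivRealProd_symm_apply]
    have h2 : ‖(x + y * Complex.I : ℂ)‖ ^ 2 = x ^ 2 + y ^ 2 := by
      rw [← Complex.normSq_eq_norm_sq, Complex.normSq_add_mul_I]
    rw [h1, h2, mul_assoc, mul_assoc, ← Complex.exp_add, ← Complex.exp_add]
    congr 2
    simp only [map_add, map_mul, Complex.conj_ofReal, Complex.conj_I]
    push_cast
    ring
  simp_rw [key]
  rw [Measure.volume_eq_prod, integral_prod_mul (fun x : ℝ => (Real.pi : ℂ)⁻¹ *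
      Complex.exp ((μ - 1) * (x : ℂ) ^ 2 + (u + v) * x + 0)) (fun y : ℝ =>
      Complex.exp ((μ - 1) * (y : ℂ) ^ 2 + (Complex.I * (u - v)) * y + 0)),
    integral_const_mul, integral_cexp_quadratic hre, integral_cexp_quadratic hre]
  have hpi : (Real.pi : ℂ) ≠ 0 := by exact_mod_cast Real.pi_ne_zero
  have h3 : ∀ w : ℂ, w ^ (1 / 2 : ℂ) * w ^ (1 / 2 : ℂ) = w := by
    intro w
    rw [← sq, ← Complex.cpow_nat_mul]
    norm_num
  calc _ = (Real.pi : ℂ)⁻¹ * ((Real.pi / -(μ - 1) : ℂ) ^ (1 / 2 : ℂ) *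
        (Real.pi / -(μ - 1) : ℂ) ^ (1 / 2 : ℂ)) *
        (Complex.exp (0 - (u + v) ^ 2 / (4 * (μ - 1))) *
        Complex.exp (0 - (Complex.I * (u - v)) ^ 2 / (4 * (μ - 1)))) := by ring
    _ = _ := by
      rw [h3, ← Complex.exp_add]
      congr 1
      · rw [neg_sub]; field_simp
      · congr 1
        rw [mul_pow, Complex.I_sq]
        have : 4 * (μ - 1) = -4 * (1 - μ) := by ring
        rw [this]
        field_simp
        ring

instance isProbabilityMeasure_gaussianC : IsProbabilityMeasure gaussianC := by
  have h := integral_gaussianC_exp (μ := 0) (by simp) 0 0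
  simp only [zero_mul, add_zero, Complex.exp_zero, integral_const, sub_zero, inv_one, zero_div,
    mul_one, Complex.real_smul] at h
  have h' : gaussianC.real Set.univ = 1 := by exact_mod_cast h
  refine ⟨?_⟩
  rw [measureReal_def] at h'
  exact (ENNReal.toReal_eq_one_iff _).mp h'

instance isProbabilityMeasure_bargmannMeasure (ι : Type) [Fintype ι] :
    IsProbabilityMeasure (bargmannMeasure ι) := by
  rw [bargmannMeasure_eq_pi]; infer_instance

variable {ι : Type} [Fintype ι]

theorem integral_bargmann_diagonal {μ : ι → ℂ} (hμ : ∀ i, (μ i).re < 1) (u v : ι → ℂ) :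
    ∫ z, Complex.exp (∑ i, (μ i * ((‖z i‖ ^ 2 : ℝ) : ℂ) + u i * z i + v i * (starRingEnd ℂ) (z i)))
        ∂(bargmannMeasure ι)
      = ∏ i, ((1 - μ i)⁻¹ * Complex.exp (u i * v i / (1 - μ i))) := by
  simp_rw [Complex.exp_sum]
  rw [bargmannMeasure_eq_pi, integral_fintype_prod_eq_prod (𝕜 := ℂ) (fun i (z : ℂ) =>
    Complex.exp (μ i * ((‖z‖ ^ 2 : ℝ) : ℂ) + u i * z + v i * (starRingEnd ℂ) z))]
  exact Finset.prod_congr rfl fun i _ => integral_gaussianC_exp (hμ i) _ _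

theorem integral_bargmann_linear (u v : ι → ℂ) :
    ∫ z, Complex.exp (∑ i, (u i * z i + v i * (starRingEnd ℂ) (z i))) ∂(bargmannMeasure ι)
      = Complex.exp (∑ i, u i * v i) := by
  have h := integral_bargmann_diagonal (μ := fun _ : ι => 0) (by simp) u v
  simpa [Complex.exp_sum] using h

theorem integrable_bargmann_exp_norm_sq {t : ℝ} (ht : t < 1) :
    Integrable (fun z : ι → ℂ => Real.exp (t * ∑ i, ‖z i‖ ^ 2)) (bargmannMeasure ι) := by
  have h := integral_bargmann_diagonal (μ := fun _ : ι => (t : ℂ)) (fun _ => by simpa using ht) 0 0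
  have h' : Integrable (fun z : ι → ℂ => Complex.exp ((t * ∑ i, ‖z i‖ ^ 2 : ℝ) : ℂ))
      (bargmannMeasure ι) := by
    -- A nonintegrable function has Bochner integral 0, so the nonzero closed form already proves
    -- integrability.
    refine Integrable.of_integral_ne_zero ?_
    have hne : (1 - (t : ℂ)) ≠ 0 := by
      intro h0
      have : ((1 - t : ℝ) : ℂ) = 0 := by push_cast; exact h0
      have := Complex.ofReal_eq_zero.mp this
      linarith
    have h2 : ∀ z : ι → ℂ, Complex.exp ((t * ∑ i, ‖z i‖ ^ 2 : ℝ) : ℂ) =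
        Complex.exp (∑ i, ((t : ℂ) * ((‖z i‖ ^ 2 : ℝ) : ℂ) + (0 : ι → ℂ) i * z i +
          (0 : ι → ℂ) i * (starRingEnd ℂ) (z i))) := by
      intro z
      congr 1
      push_cast
      simp [Finset.mul_sum]
    simp_rw [h2]
    rw [h]
    refine Finset.prod_ne_zero_iff.mpr fun i _ => mul_ne_zero (inv_ne_zero hne) (Complex.exp_ne_zero _)
  refine h'.norm.congr (Filter.Eventually.of_forall fun z => ?_)
  simp only [Complex.norm_exp, Complex.ofReal_re]

theorem charFunDual_bargmann (L : StrongDual ℝ (ι → ℂ)) (c : ι → ℂ)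
    (hL : ∀ x, L x = (∑ i, c i * x i).re) :
    ∫ x, Complex.exp (L x * Complex.I) ∂(bargmannMeasure ι)
      = Complex.exp (-(∑ i, c i * (starRingEnd ℂ) (c i)) / 4) := by
  have h := integral_bargmann_linear (fun i => Complex.I / 2 * c i)
    (fun i => Complex.I / 2 * (starRingEnd ℂ) (c i))
  have h1 : ∀ x : ι → ℂ, Complex.exp (L x * Complex.I) = Complex.exp (∑ i, (Complex.I / 2 * c i * x i
      + Complex.I / 2 * (starRingEnd ℂ) (c i) * (starRingEnd ℂ) (x i))) := by
    intro x
    congr 1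
    rw [hL, Complex.re_eq_add_conj, map_sum, ← Finset.sum_add_distrib, Finset.sum_div, Finset.sum_mul]
    refine Finset.sum_congr rfl fun i _ => ?_
    rw [map_mul]
    ring
  simp_rw [h1]
  rw [h]
  congr 1
  rw [neg_div, Finset.sum_div, ← Finset.sum_neg_distrib]
  refine Finset.sum_congr rfl fun i _ => ?_
  linear_combination (c i * (starRingEnd ℂ) (c i) / 4) * Complex.I_sq

/-- A real functional on ℂ is the real part of a complex one, z ↦ (L 1 - i L i) z, applied here in
each coordinate. -/
theorem exists_dual_coefficients [DecidableEq ι] (L : StrongDual ℝ (ι → ℂ)) :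
    ∃ c : ι → ℂ, ∀ x, L x = (∑ i, c i * x i).re := by
  refine ⟨fun i => L (Pi.single i 1) - Complex.I * L (Pi.single i Complex.I), fun x => ?_⟩
  have hx : x = ∑ i, ((x i).re • (Pi.single i (1 : ℂ) : ι → ℂ) +
      (x i).im • (Pi.single i Complex.I : ι → ℂ)) := by
    ext j
    simp [Finset.sum_apply, Pi.single_apply, Complex.re_add_im, Finset.sum_add_distrib]
  conv_lhs => rw [hx]
  simp only [map_sum, map_add, map_smul, smul_eq_mul, Complex.re_sum]
  refine Finset.sum_congr rfl fun i _ => ?_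
  simp [Complex.mul_re]
  ring

/-- The Bargmann measure is invariant under unitary matrices. -/
theorem measurePreserving_bargmann_mulVec [DecidableEq ι] {W : Matrix ι ι ℂ}
    (hW : W * W.conjTranspose = 1) :
    MeasurePreserving (fun z => W.mulVec z) (bargmannMeasure ι) (bargmannMeasure ι) := by
  let T : (ι → ℂ) →L[ℝ] (ι → ℂ) := LinearMap.toContinuousLinearMap (W.mulVecLin.restrictScalars ℝ)
  have hT : ∀ x, T x = W.mulVec x := fun x => rfl
  have hm : Measurable fun z : ι → ℂ => W.mulVec z := T.continuous.measurable
  refine ⟨hm, ?_⟩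
  have : IsProbabilityMeasure ((bargmannMeasure ι).map fun z => W.mulVec z) :=
    Measure.isProbabilityMeasure_map hm.aemeasurable
  -- The characteristic function depends on the functional only through ∑ |cᵢ|², and precomposing
  -- with W replaces c by cW, which has the same norm.
  refine Measure.ext_of_charFunDual ?_
  ext L
  obtain ⟨c, hc⟩ := exists_dual_coefficients L
  rw [charFunDual_apply, charFunDual_apply, charFunDual_bargmann L c hc,
    integral_map hm.aemeasurable (by fun_prop)]
  have hc' : ∀ x, (L.comp T) x = (∑ i, Matrix.vecMul c W i * x i).re := by
    intro x
    rw [ContinuousLinearMap.comp_apply, hT, hc]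
    change (dotProduct c (W.mulVec x)).re = (dotProduct _ x).re
    rw [Matrix.dotProduct_mulVec]
  have := charFunDual_bargmann (L.comp T) _ hc'
  simp only [ContinuousLinearMap.comp_apply, hT] at this
  rw [this]
  congr 3
  change dotProduct (Matrix.vecMul c W) (star (Matrix.vecMul c W)) = dotProduct c (star c)
  rw [Matrix.star_vecMul, Matrix.dotProduct_mulVec, Matrix.vecMul_vecMul, hW, Matrix.vecMul_one]

end

section

/-! ### Diagonalization of unitary matrices and sesquilinear Gaussian integrals -/

variable {ι : Type} [Fintype ι] [DecidableEq ι]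

/-- The spectrum is finite while the unit circle is infinite. The phase makes the Cayley transform
available even when 1 is an eigenvalue. -/
theorem exists_norm_eq_one_isUnit_sub (V : Matrix ι ι ℂ) :
    ∃ ω : ℂ, ‖ω‖ = 1 ∧ IsUnit (1 - ω • V).det := by
  by_contra! h
  -- The points e^{in} are pairwise distinct because π is irrational.
  have hinf : (Set.range fun n : ℕ => Complex.exp ((n : ℂ) * Complex.I)).Infinite := by
    refine Set.infinite_range_of_injective fun a b hab => ?_
    obtain ⟨k, hk⟩ := Complex.exp_eq_exp_iff_exists_int.mp hab
    have h1 : (a : ℂ) = b + k * (2 * Real.pi) := by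
      have : Complex.I ≠ 0 := Complex.I_ne_zero
      apply mul_right_cancel₀ this
      linear_combination hk
    have h2 : (a : ℝ) = b + k * (2 * Real.pi) := by exact_mod_cast h1
    by_cases hk0 : k = 0
    · subst hk0; simpa using h2
    · exfalso
      have hirr := irrational_pi
      apply hirr
      refine ⟨((a : ℚ) - b) / (2 * k), ?_⟩
      have : (k : ℝ) ≠ 0 := by exact_mod_cast hk0
      push_cast
      rw [h2]
      field_simp
      ring
  have hfin : (spectrum ℂ V).Finite := Matrix.finite_spectrum V
  refine hinf (hfin.subset ?_)
  rintro _ ⟨n, rfl⟩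
  set ω := Complex.exp ((n : ℂ) * Complex.I) with hω
  have hω0 : ω ≠ 0 := Complex.exp_ne_zero _
  have hω1 : ‖ω⁻¹‖ = 1 := by rw [norm_inv, hω, Complex.norm_exp]; simp
  have := h ω⁻¹ hω1
  rw [spectrum.mem_iff]
  intro hu
  apply this
  rw [← Matrix.isUnit_iff_isUnit_det]
  have h3 : (algebraMap ℂ (Matrix ι ι ℂ) ω - V) = ω • (1 - ω⁻¹ • V) := by
    rw [smul_sub, smul_smul, mul_inv_cancel₀ hω0, one_smul, Algebra.algebraMap_eq_smul_one]
  rw [h3] at hu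
  exact (isUnit_smul_iff (Units.mk0 ω hω0) (1 - ω⁻¹ • V)).mp hu

/-- Unitary matrices are unitarily diagonalizable, by the Cayley transform. -/
theorem exists_unitary_diagonalization {V : Matrix ι ι ℂ} (hV : V * Vᴴ = 1) :
    ∃ (W : Matrix ι ι ℂ) (d : ι → ℂ), W * Wᴴ = 1 ∧ V = W * diagonal d * Wᴴ := by
  obtain ⟨ω, hω, hdet⟩ := exists_norm_eq_one_isUnit_sub V
  have hωc : ω * (starRingEnd ℂ) ω = 1 := by
    rw [Complex.mul_conj, Complex.normSq_eq_norm_sq, hω]; simp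
  have hω0 : ω ≠ 0 := by rintro rfl; simp at hω
  set V' := ω • V with hV'
  have hV1 : V' * V'ᴴ = 1 := by
    rw [hV', conjTranspose_smul, smul_mul_smul_comm, hV]
    simp [hωc]
  have hV2 : V'ᴴ * V' = 1 := mul_eq_one_comm.mp hV1
  set K := (1 - V')⁻¹ with hK
  have hK1 : (1 - V') * K = 1 := mul_nonsing_inv _ hdet
  have hK2 : K * (1 - V') = 1 := nonsing_inv_mul _ hdet
  have hKs : Kᴴ * (1 - V'ᴴ) = 1 := by
    have := congrArg conjTranspose hK1
    simpa [conjTranspose_mul] using this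
  -- Formally (1 - V'⁻¹)⁻¹ = -V'(1 - V')⁻¹. It yields K + Kᴴ = 1, so K - ½ is skew-Hermitian and the
  -- spectral theorem applies to i(K - ½).
  have hKstar : Kᴴ = -(V' * K) := by
    have e : (1 - V'ᴴ) * -(V' * K) = 1 := by
      calc (1 - V'ᴴ) * -(V' * K) = (V'ᴴ * V') * K - V' * K := by noncomm_ring
        _ = 1 := by rw [hV2, one_mul, ← hK1, sub_mul, one_mul]
    calc Kᴴ = Kᴴ * ((1 - V'ᴴ) * -(V' * K)) := by rw [e, mul_one]
      _ = -(V' * K) := by rw [← mul_assoc, hKs, one_mul]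
  have hsum : K + Kᴴ = 1 := by
    rw [hKstar]
    calc K + -(V' * K) = (1 - V') * K := by noncomm_ring
      _ = 1 := hK1
  set H : Matrix ι ι ℂ := Complex.I • (K - (1 / 2 : ℂ) • 1) with hH
  have hHerm : H.IsHermitian := by
    have hKs' : Kᴴ = 1 - K := by rw [← hsum]; abel
    rw [Matrix.IsHermitian, hH, conjTranspose_smul, conjTranspose_sub, conjTranspose_smul, hKs',
      conjTranspose_one]
    ext i j
    simp
    ring
  have hspec := hHerm.spectral_theorem
  rw [Unitary.conjStarAlgAut_apply] at hspec
  set W : Matrix ι ι ℂ := (hHerm.eigenvectorUnitary : Matrix ι ι ℂ) with hWdef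
  have hW1 : W * Wᴴ = 1 := by
    simpa [star_eq_conjTranspose] using Unitary.coe_mul_star_self hHerm.eigenvectorUnitary
  have hW2 : Wᴴ * W = 1 := mul_eq_one_comm.mp hW1
  have hspec' : H = W * diagonal (fun i => (hHerm.eigenvalues i : ℂ)) * Wᴴ := hspec
  let e : ι → ℂ := fun i => 1 / 2 - Complex.I * hHerm.eigenvalues i
  have hKd : K = W * diagonal e * Wᴴ := by
    have h1 : K = (1 / 2 : ℂ) • (W * Wᴴ) - Complex.I • H := by
      rw [hW1, hH, smul_smul, Complex.I_mul_I]
      module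
    have h2 : diagonal e = (1 / 2 : ℂ) • (1 : Matrix ι ι ℂ) -
        Complex.I • diagonal (fun i => (hHerm.eigenvalues i : ℂ)) := by
      ext i j
      by_cases hij : i = j
      · subst hij; simp [e]
      · simp [hij]
    rw [h1, h2]
    simp only [mul_sub, sub_mul, Matrix.mul_smul, Matrix.smul_mul, Matrix.mul_one]
    rw [← hspec']
  have hed : diagonal e * (Wᴴ * (1 - V') * W) = 1 := by
    calc diagonal e * (Wᴴ * (1 - V') * W)
        = Wᴴ * W * diagonal e * Wᴴ * (1 - V') * W := by rw [hW2]; noncomm_ring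
      _ = Wᴴ * (W * diagonal e * Wᴴ * (1 - V')) * W := by noncomm_ring
      _ = 1 := by rw [← hKd, hK2, mul_one, hW2]
  have hdiag : Wᴴ * (1 - V') * W = diagonal fun i => (e i)⁻¹ := by
    ext i j
    have := congrFun (congrFun hed i) j
    rw [diagonal_mul] at this
    have hii := congrFun (congrFun hed i) i
    rw [diagonal_mul, one_apply_eq] at hii
    have hei : e i ≠ 0 := by
      intro h0; rw [h0, zero_mul] at hii; exact zero_ne_one hii
    by_cases hij : i = j
    · subst hij
      rw [diagonal_apply_eq]
      field_simp
      rw [mul_comm]; exact hii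
    · rw [one_apply_ne hij] at this
      rw [diagonal_apply_ne _ hij]
      exact (mul_eq_zero.mp this).resolve_left hei
  refine ⟨W, fun i => ω⁻¹ * (1 - (e i)⁻¹), hW1, ?_⟩
  have h5 : V' = W * (1 - diagonal fun i => (e i)⁻¹) * Wᴴ := by
    rw [← hdiag]
    calc V' = W * Wᴴ - (W * Wᴴ) * (1 - V') * (W * Wᴴ) := by rw [hW1]; noncomm_ring
      _ = _ := by noncomm_ring
  have h6 : V = ω⁻¹ • V' := by rw [hV', smul_smul, inv_mul_cancel₀ hω0, one_smul]
  have h7 : (diagonal fun i => ω⁻¹ * (1 - (e i)⁻¹)) = ω⁻¹ • (1 - diagonal fun i => (e i)⁻¹) := by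
    ext i j
    by_cases hij : i = j
    · subst hij; simp
    · simp [hij]
  rw [h6, h5, h7]
  simp

theorem norm_eq_one_of_diagonalization {V W : Matrix ι ι ℂ} {d : ι → ℂ} (hV : V * Vᴴ = 1)
    (hW : W * Wᴴ = 1) (h : V = W * diagonal d * Wᴴ) (i : ι) : ‖d i‖ = 1 := by
  have hW2 : Wᴴ * W = 1 := mul_eq_one_comm.mp hW
  have h1 : diagonal d = Wᴴ * V * W := by
    rw [h]
    calc diagonal d = (Wᴴ * W) * diagonal d * (Wᴴ * W) := by rw [hW2]; simp
      _ = _ := by noncomm_ring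
  have h2 : diagonal d * (diagonal d)ᴴ = 1 := by
    rw [h1]
    calc Wᴴ * V * W * (Wᴴ * V * W)ᴴ = Wᴴ * (V * ((W * Wᴴ) * Vᴴ)) * W := by
          simp only [conjTranspose_mul, conjTranspose_conjTranspose]; noncomm_ring
      _ = 1 := by rw [hW, one_mul, hV, mul_one, hW2]
  have h3 := congrFun (congrFun h2 i) i
  rw [diagonal_conjTranspose, diagonal_mul_diagonal, diagonal_apply_eq, one_apply_eq] at h3
  have h4 : d i * (starRingEnd ℂ) (d i) = 1 := h3
  rw [Complex.mul_conj, Complex.normSq_eq_norm_sq] at h4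
  have h5 : ‖d i‖ ^ 2 = 1 := by exact_mod_cast h4
  nlinarith [norm_nonneg (d i)]

/-- Unitary invariance of the measure moves to the eigenbasis of V, where the integral is a product
over modes; it converges because Re(τ dᵢ) ≤ τ < 1. -/
theorem integral_bargmann_sesquilinear {V W : Matrix ι ι ℂ} {d : ι → ℂ} (hV : V * Vᴴ = 1)
    (hW : W * Wᴴ = 1) (hd : V = W * diagonal d * Wᴴ) {τ : ℝ} (h0 : 0 ≤ τ) (h1 : τ < 1) :
    ∫ a, Complex.exp (τ * (star a ⬝ᵥ V *ᵥ a)) ∂(bargmannMeasure ι) =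
      (∏ i, (1 - τ * d i))⁻¹ := by
  have hW2 : Wᴴ * W = 1 := mul_eq_one_comm.mp hW
  have hdn := norm_eq_one_of_diagonalization hV hW hd
  have hmp := measurePreserving_bargmann_mulVec hW
  rw [← hmp.map_eq, integral_map hmp.measurable.aemeasurable]
  swap
  · refine Continuous.aestronglyMeasurable ?_
    unfold dotProduct mulVec dotProduct
    simp only [Pi.star_apply]
    fun_prop
  have key : ∀ a : ι → ℂ, Complex.exp (τ * (star (W *ᵥ a) ⬝ᵥ V *ᵥ (W *ᵥ a))) =
      Complex.exp (∑ i, ((τ * d i) * ((‖a i‖ ^ 2 : ℝ) : ℂ) + (0 : ι → ℂ) i * a i +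
        (0 : ι → ℂ) i * (starRingEnd ℂ) (a i))) := by
    intro a
    congr 1
    have e1 : star (W *ᵥ a) ⬝ᵥ V *ᵥ (W *ᵥ a) = star a ⬝ᵥ diagonal d *ᵥ a := by
      rw [star_mulVec, ← dotProduct_mulVec, mulVec_mulVec, mulVec_mulVec]
      congr 2
      rw [hd]
      calc Wᴴ * (W * diagonal d * Wᴴ) * W = (Wᴴ * W) * diagonal d * (Wᴴ * W) := by noncomm_ring
        _ = _ := by rw [hW2]; simp
    rw [e1, dotProduct, Finset.mul_sum]
    refine Finset.sum_congr rfl fun i _ => ?_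
    rw [mulVec_diagonal, Pi.star_apply, ← Complex.normSq_eq_norm_sq, Complex.normSq_eq_conj_mul_self]
    simp only [Pi.zero_apply, zero_mul, add_zero, Complex.star_def]
    ring
  simp_rw [key]
  rw [integral_bargmann_diagonal]
  · simp only [Pi.zero_apply, zero_mul, zero_div, Complex.exp_zero, mul_one]
    rw [Finset.prod_inv_distrib]
  · intro i
    calc ((τ : ℂ) * d i).re ≤ ‖(τ : ℂ) * d i‖ := Complex.re_le_norm _
      _ = τ := by rw [norm_mul, hdn, Complex.norm_real, Real.norm_of_nonneg h0, mul_one]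
      _ < 1 := h1

end

section

/-! ### Quadratic Gaussian integrals -/

variable {ι : Type} [Fintype ι] [DecidableEq ι]

/-- The hypotheses say that the rows of the 2 × 2 matrix are orthonormal, so it acts unitarily on
two copies of the modes, regarded as one system indexed by `ι ⊕ ι`. Two beam splitters are
instances: one evaluates quadratic Gaussian integrals, the other linearizes the swap. -/
theorem measurePreserving_bargmann_prod_rotation {α β γ δ : ℂ}
    (h1 : α * star α + β * star β = 1) (h2 : γ * star γ + δ * star δ = 1)
    (h3 : α * star γ + β * star δ = 0) :
    MeasurePreserving (fun p : (ι → ℂ) × (ι → ℂ) => (α • p.1 + β • p.2, γ • p.1 + δ • p.2))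
      ((bargmannMeasure ι).prod (bargmannMeasure ι))
      ((bargmannMeasure ι).prod (bargmannMeasure ι)) := by
  have h4 : γ * star α + δ * star β = 0 := by
    have := congrArg star h3
    simp only [star_add, star_mul', star_star, star_zero] at this
    linear_combination this
  let W : Matrix (ι ⊕ ι) (ι ⊕ ι) ℂ := fromBlocks (α • 1) (β • 1) (γ • 1) (δ • 1)
  have hW : W * Wᴴ = 1 := by
    simp only [W, fromBlocks_conjTranspose, fromBlocks_multiply, conjTranspose_smul,
      conjTranspose_one, Matrix.mul_smul, Matrix.mul_one, smul_smul, ← add_smul, mul_comm (star _)]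
    rw [h1, h2, h3, h4, one_smul, zero_smul, fromBlocks_one]
  have e := measurePreserving_sumPiEquivProdPi (X := fun _ : ι ⊕ ι => ℂ) (fun _ => gaussianC)
  have m := (e.comp (measurePreserving_bargmann_mulVec hW)).comp e.symm
  have hfun : ((MeasurableEquiv.sumPiEquivProdPi fun _ : ι ⊕ ι => ℂ) ∘ fun z => W.mulVec z) ∘
      (MeasurableEquiv.sumPiEquivProdPi fun _ : ι ⊕ ι => ℂ).symm =
      fun p : (ι → ℂ) × (ι → ℂ) => (α • p.1 + β • p.2, γ • p.1 + δ • p.2) := by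
    funext p
    obtain ⟨a, b⟩ := p
    have : (MeasurableEquiv.sumPiEquivProdPi fun _ : ι ⊕ ι => ℂ).symm (a, b) = Sum.elim a b := by
      ext i; cases i <;> rfl
    simp only [Function.comp_apply, this, W, fromBlocks_mulVec]
    refine Prod.ext ?_ ?_ <;> ext i <;>
      simp [MeasurableEquiv.coe_sumPiEquivProdPi, Matrix.smul_mulVec, Equiv.sumPiEquivProdPi]
  rw [hfun] at m
  exact m

omit [DecidableEq ι] in
theorem norm_dotProduct_le (z w : ι → ℂ) :
    ‖z ⬝ᵥ w‖ ≤ (∑ i, ‖z i‖ ^ 2 + ∑ i, ‖w i‖ ^ 2) / 2 := by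
  rw [dotProduct, ← Finset.sum_add_distrib, Finset.sum_div]
  refine (norm_sum_le _ _).trans (Finset.sum_le_sum fun i _ => ?_)
  rw [norm_mul]
  nlinarith [sq_nonneg (‖z i‖ - ‖w i‖)]

omit [DecidableEq ι] in
theorem ofReal_sum_norm_sq (z : ι → ℂ) : ((∑ i, ‖z i‖ ^ 2 : ℝ) : ℂ) = star z ⬝ᵥ z := by
  push_cast
  refine Finset.sum_congr rfl fun i _ => ?_
  rw [Pi.star_apply, Complex.star_def, Complex.conj_mul']

theorem sum_norm_sq_mulVec {P : Matrix ι ι ℂ} (hP : Pᴴ * P = 1) (z : ι → ℂ) :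
    ∑ i, ‖(P *ᵥ z) i‖ ^ 2 = ∑ i, ‖z i‖ ^ 2 := by
  have : ((∑ i, ‖(P *ᵥ z) i‖ ^ 2 : ℝ) : ℂ) = ((∑ i, ‖z i‖ ^ 2 : ℝ) : ℂ) := by
    rw [ofReal_sum_norm_sq, ofReal_sum_norm_sq, star_mulVec, dotProduct_mulVec, vecMul_vecMul, hP,
      vecMul_one]
  exact_mod_cast this

theorem norm_quadratic_le {P : Matrix ι ι ℂ} (hP : P * Pᴴ = 1) (z : ι → ℂ) :
    ‖z ⬝ᵥ P *ᵥ z‖ ≤ ∑ i, ‖z i‖ ^ 2 := by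
  refine (norm_dotProduct_le _ _).trans ?_
  rw [sum_norm_sq_mulVec (mul_eq_one_comm.mp hP)]
  linarith

omit [DecidableEq ι] in
theorem continuous_quadratic (P : Matrix ι ι ℂ) : Continuous fun z : ι → ℂ => z ⬝ᵥ P *ᵥ z := by
  unfold dotProduct mulVec dotProduct
  fun_prop

theorem integrable_gaussian_quadratic {P A : Matrix ι ι ℂ} (hP : P * Pᴴ = 1) (hA : A * Aᴴ = 1)
    {t : ℝ} (h0 : 0 ≤ t) (h1 : t < 1) :
    Integrable (fun z : ι → ℂ => Complex.exp (t / 2 * (z ⬝ᵥ P *ᵥ z) + t / 2 * star (z ⬝ᵥ A *ᵥ z)))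
      (bargmannMeasure ι) := by
  refine (integrable_bargmann_exp_norm_sq h1).mono' ?_ (Filter.Eventually.of_forall fun z => ?_)
  · have := continuous_quadratic P
    have := continuous_quadratic A
    exact Continuous.aestronglyMeasurable (by fun_prop)
  · rw [Complex.norm_exp]
    refine Real.exp_le_exp.mpr ((Complex.re_le_norm _).trans ((norm_add_le _ _).trans ?_))
    have ht : ‖(t / 2 : ℂ)‖ = t / 2 := by
      rw [norm_div, Complex.norm_real, Real.norm_of_nonneg h0]; simp
    rw [norm_mul, norm_mul, norm_star, ht]
    have := norm_quadratic_le hP z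
    have := norm_quadratic_le hA z
    nlinarith

/-- The Gaussian integral of `exp (t/2 zᵀPz + t/2 conj (zᵀAz))` for symmetric unitary `P`, `A`. -/
theorem integral_gaussian_quadratic_sq {P A W : Matrix ι ι ℂ} {d : ι → ℂ} (hP : P * Pᴴ = 1)
    (hA : A * Aᴴ = 1) (hPs : Pᵀ = P) (hAs : Aᵀ = A) (hW : W * Wᴴ = 1)
    (hd : Aᴴ * P = W * diagonal d * Wᴴ) {t : ℝ} (h0 : 0 ≤ t) (h1 : t < 1) :
    (∫ z : ι → ℂ, Complex.exp (t / 2 * (z ⬝ᵥ P *ᵥ z) + t / 2 * star (z ⬝ᵥ A *ᵥ z))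
      ∂(bargmannMeasure ι)) ^ 2 = (∏ i, (1 - (t : ℂ) ^ 2 * d i))⁻¹ := by
  have hint := integrable_gaussian_quadratic hP hA h0 h1
  set f := fun z : ι → ℂ => Complex.exp (t / 2 * (z ⬝ᵥ P *ᵥ z) + t / 2 * star (z ⬝ᵥ A *ᵥ z))
    with hf
  set κ : ℂ := (((Real.sqrt 2)⁻¹ : ℝ) : ℂ) with hκ
  have hκ2 : κ * κ = 1 / 2 := by
    rw [hκ, ← Complex.ofReal_mul, ← mul_inv, Real.mul_self_sqrt (by norm_num)]; simp
  have hκs : star κ = κ := by rw [hκ, Complex.star_def, Complex.conj_ofReal]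
  -- The square of the integral is an integral over two copies, rotated to (a + b)/√2 and i(b -
  -- a)/√2. The factor i cancels the pure squares and leaves only the cross term 2 aᵀQb. The
  -- integral over b is then linear, and the one over a sesquilinear with matrix AᴴP.
  have hmp := measurePreserving_bargmann_prod_rotation (ι := ι) (α := κ) (β := κ)
    (γ := -Complex.I * κ) (δ := Complex.I * κ)
    (by rw [hκs]; linear_combination 2 * hκ2)
    (by simp only [star_mul', hκs, star_neg, Complex.star_def, Complex.conj_I]
        linear_combination -2 * Complex.I * Complex.I * hκ2 - Complex.I_sq)
    (by simp only [star_mul', hκs, star_neg, Complex.star_def, Complex.conj_I]; ring)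
  have hprod : Integrable (fun p : (ι → ℂ) × (ι → ℂ) => f p.1 * f p.2)
      ((bargmannMeasure ι).prod (bargmannMeasure ι)) := hint.mul_prod hint
  have hsymm : ∀ (Q : Matrix ι ι ℂ), Qᵀ = Q → ∀ a b : ι → ℂ, b ⬝ᵥ Q *ᵥ a = a ⬝ᵥ Q *ᵥ b := by
    intro Q hQ a b
    rw [dotProduct_mulVec, ← mulVec_transpose, hQ, dotProduct_comm]
  have hquad : ∀ (Q : Matrix ι ι ℂ), Qᵀ = Q → ∀ a b : ι → ℂ,
      (κ • a + κ • b) ⬝ᵥ Q *ᵥ (κ • a + κ • b) + ((-Complex.I * κ) • a + (Complex.I * κ) • b) ⬝ᵥ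
        Q *ᵥ ((-Complex.I * κ) • a + (Complex.I * κ) • b) = 2 * (a ⬝ᵥ Q *ᵥ b) := by
    intro Q hQ a b
    simp only [mulVec_add, mulVec_smul, dotProduct_add, add_dotProduct, dotProduct_smul,
      smul_dotProduct, smul_eq_mul]
    rw [hsymm Q hQ a b]
    linear_combination (4 * (a ⬝ᵥ Q *ᵥ b)) * hκ2 + (κ * κ * (a ⬝ᵥ Q *ᵥ a) +
      κ * κ * (b ⬝ᵥ Q *ᵥ b) - 2 * κ * κ * (a ⬝ᵥ Q *ᵥ b)) * Complex.I_sq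
  have hpair : ∀ a b : ι → ℂ, f (κ • a + κ • b) * f ((-Complex.I * κ) • a + (Complex.I * κ) • b) =
      Complex.exp (∑ i, ((t • (a ᵥ* P)) i * b i +
        (t • star (a ᵥ* A)) i * (starRingEnd ℂ) (b i))) := by
    intro a b
    simp only [hf]
    rw [← Complex.exp_add]
    congr 1
    have e1 := hquad P hPs a b
    have e2 := congrArg star (hquad A hAs a b)
    have e3 : ∑ i, ((t • (a ᵥ* P)) i * b i + (t • star (a ᵥ* A)) i * (starRingEnd ℂ) (b i)) =
        t * (a ⬝ᵥ P *ᵥ b) + t * star (a ⬝ᵥ A *ᵥ b) := by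
      rw [Finset.sum_add_distrib, dotProduct_mulVec a P, dotProduct_mulVec a A, dotProduct, dotProduct,
        star_sum, Finset.mul_sum, Finset.mul_sum]
      congr 1 <;> refine Finset.sum_congr rfl fun i _ => ?_
      · simp [mul_assoc]
      · simp [mul_assoc]
    rw [e3]
    simp only [star_add, star_mul', star_ofNat] at e2
    linear_combination (t / 2 : ℂ) * e1 + (t / 2 : ℂ) * e2
  have hstep : (∫ z, f z ∂(bargmannMeasure ι)) ^ 2 =
      ∫ a, ∫ b, Complex.exp (∑ i, ((t • (a ᵥ* P)) i * b i +
        (t • star (a ᵥ* A)) i * (starRingEnd ℂ) (b i))) ∂(bargmannMeasure ι)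
        ∂(bargmannMeasure ι) := by
    rw [sq, ← integral_prod_mul f f, ← hmp.map_eq, integral_map hmp.measurable.aemeasurable]
    · have hint2 := hmp.integrable_comp_of_integrable hprod
      refine (integral_prod _ hint2).trans ?_
      simp only [Function.comp, hpair]
    · rw [hmp.map_eq]; exact hprod.aestronglyMeasurable
  rw [hstep]
  simp_rw [integral_bargmann_linear]
  have hV : (Aᴴ * P) * (Aᴴ * P)ᴴ = 1 := by
    rw [conjTranspose_mul, conjTranspose_conjTranspose, mul_assoc, ← mul_assoc P, hP, one_mul,
      mul_eq_one_comm.mp hA]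
  rw [← Complex.ofReal_pow, ← integral_bargmann_sesquilinear hV hW hd (sq_nonneg t) (by nlinarith)]
  refine integral_congr_ae (Filter.Eventually.of_forall fun a => ?_)
  simp only
  congr 1
  have : ∑ i, (t • (a ᵥ* P)) i * (t • star (a ᵥ* A)) i = (t : ℂ) ^ 2 * ((a ᵥ* P) ⬝ᵥ star (a ᵥ* A)) := by
    rw [dotProduct, Finset.mul_sum]
    refine Finset.sum_congr rfl fun i _ => ?_
    simp
    ring
  rw [this, Complex.ofReal_pow]
  congr 1
  have hAh : (Aᴴ)ᵀ = Aᴴ := by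
    ext i j
    simp only [transpose_apply, conjTranspose_apply]
    exact congrArg star (congrFun (congrFun hAs j) i)
  rw [dotProduct_comm, star_vecMul, ← mulVec_transpose P a, hPs, ← mulVec_mulVec,
    dotProduct_mulVec (star a), ← mulVec_transpose Aᴴ, hAh]

end

section

/-! ### Purity as the expectation of a parity -/

theorem measurePreserving_prodProdProdComm {α β γ δ : Type*} [MeasurableSpace α]
    [MeasurableSpace β] [MeasurableSpace γ] [MeasurableSpace δ] (μa : Measure α) (μb : Measure β)
    (μc : Measure γ) (μd : Measure δ) [SFinite μa] [SFinite μb] [SFinite μc] [SFinite μd] :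
    MeasurePreserving (fun p : (α × β) × (γ × δ) => ((p.1.1, p.2.1), (p.1.2, p.2.2)))
      ((μa.prod μb).prod (μc.prod μd)) ((μa.prod μc).prod (μb.prod μd)) := by
  have h1 := measurePreserving_prodAssoc μa μb (μc.prod μd)
  have h2 := (MeasurePreserving.id μa).prod (measurePreserving_prodAssoc μb μc μd).symm
  have h3 := (MeasurePreserving.id μa).prod
    ((Measure.measurePreserving_swap (μ := μb) (ν := μc)).prod (MeasurePreserving.id μd))
  have h4 := (MeasurePreserving.id μa).prod (measurePreserving_prodAssoc μc μb μd)
  have h5 := (measurePreserving_prodAssoc μa μc (μb.prod μd)).symm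
  exact h5.comp (h4.comp (h3.comp (h2.comp h1)))

variable {ι : Type} [Fintype ι] [DecidableEq ι]

theorem measurePreserving_glue (Γ : Finset ι) :
    MeasurePreserving (fun q : ({i // i ∈ Γ} → ℂ) × ({i // i ∉ Γ} → ℂ) => glue Γ q.1 q.2)
      ((bargmannMeasure {i // i ∈ Γ}).prod (bargmannMeasure {i // i ∉ Γ})) (bargmannMeasure ι) := by
  have h := (measurePreserving_piEquivPiSubtypeProd (fun _ : ι => gaussianC) (· ∈ Γ)).symm
  -- The two sides may carry different `Fintype` instances on the subtype.
  have e1 : bargmannMeasure {i // i ∈ Γ} =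
      @Measure.pi {i // i ∈ Γ} (fun _ => ℂ) (Subtype.fintype _) _ fun _ => gaussianC := by
    rw [bargmannMeasure_eq_pi]
    congr
    exact Subsingleton.elim _ _
  have e2 : bargmannMeasure {i // i ∉ Γ} =
      @Measure.pi {i // i ∉ Γ} (fun _ => ℂ) (Subtype.fintype _) _ fun _ => gaussianC := by
    rw [bargmannMeasure_eq_pi]
  rw [e1, e2]
  exact h

/-- The vector that agrees with `x` on `Γ` and with `y` off `Γ`. -/
def mix (Γ : Finset ι) (x y : ι → ℂ) : ι → ℂ := fun i => if i ∈ Γ then x i else y i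

omit [Fintype ι] in
theorem mix_glue (Γ : Finset ι) (z w : {i // i ∈ Γ} → ℂ) (y y' : {i // i ∉ Γ} → ℂ) :
    mix Γ (glue Γ z y) (glue Γ w y') = glue Γ z y' := by
  ext i
  by_cases h : i ∈ Γ <;> simp [mix, glue, h]

/-- The parity of the modes in `Γ`. -/
def parity (Γ : Finset ι) : Matrix ι ι ℂ := diagonal fun i => if i ∈ Γ then -1 else 1

theorem sum_norm_sq_mix (Γ : Finset ι) (x y : ι → ℂ) :
    ∑ i, ‖mix Γ x y i‖ ^ 2 + ∑ i, ‖mix Γ y x i‖ ^ 2 = ∑ i, ‖x i‖ ^ 2 + ∑ i, ‖y i‖ ^ 2 := by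
  rw [← Finset.sum_add_distrib, ← Finset.sum_add_distrib]
  refine Finset.sum_congr rfl fun i _ => ?_
  by_cases h : i ∈ Γ <;> simp [mix, h, add_comm]

omit [Fintype ι] in
theorem continuous_mix (Γ : Finset ι) :
    Continuous fun p : (ι → ℂ) × (ι → ℂ) => mix Γ p.1 p.2 := by
  refine continuous_pi fun i => ?_
  by_cases h : i ∈ Γ <;> simp only [mix, h, if_true, if_false] <;> fun_prop

/-- `Tr ρ²` as an expectation of the swap of the modes in `Γ` on two copies of the state. -/
theorem traceSq_reducedDensity_eq_integral_mix (Γ : Finset ι) {F : (ι → ℂ) → ℂ} (hF : Continuous F)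
    {K r : ℝ} (hr : r < 1) (hb : ∀ x, ‖F x‖ ≤ K * Real.exp (r / 2 * ∑ i, ‖x i‖ ^ 2)) :
    Integrable (fun p : (ι → ℂ) × (ι → ℂ) => (F p.1 * F p.2) *
        (starRingEnd ℂ) (F (mix Γ p.1 p.2) * F (mix Γ p.2 p.1)))
      ((bargmannMeasure ι).prod (bargmannMeasure ι)) ∧
    traceSq (reducedDensity Γ F) =
      ∫ p : (ι → ℂ) × (ι → ℂ), (F p.1 * F p.2) *
        (starRingEnd ℂ) (F (mix Γ p.1 p.2) * F (mix Γ p.2 p.1))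
        ∂((bargmannMeasure ι).prod (bargmannMeasure ι)) := by
  set Φ : (ι → ℂ) × (ι → ℂ) → ℂ := fun p => (F p.1 * F p.2) *
        (starRingEnd ℂ) (F (mix Γ p.1 p.2) * F (mix Γ p.2 p.1)) with hΦ
  have hcont : Continuous Φ := by
    have h1 := continuous_mix Γ
    have h2 : Continuous fun p : (ι → ℂ) × (ι → ℂ) => mix Γ p.2 p.1 := h1.comp continuous_swap
    have h3 := Complex.continuous_conj
    fun_prop
  have hint : Integrable Φ ((bargmannMeasure ι).prod (bargmannMeasure ι)) := by
    -- `mix` only exchanges coordinates between the copies, so the four growth factors multiply to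
    -- exp(r(|x|² + |y|²)), integrable for r < 1.
    have h1 := integrable_bargmann_exp_norm_sq (ι := ι) hr
    refine ((h1.mul_prod h1).const_mul (K ^ 4)).mono' hcont.aestronglyMeasurable
      (Filter.Eventually.of_forall fun p => ?_)
    have hK : ∀ x : ι → ℂ, 0 ≤ K * Real.exp (r / 2 * ∑ i, ‖x i‖ ^ 2) :=
      fun x => (norm_nonneg (F x)).trans (hb x)
    calc ‖Φ p‖ = (‖F p.1‖ * ‖F p.2‖) * (‖F (mix Γ p.1 p.2)‖ * ‖F (mix Γ p.2 p.1)‖) := by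
          simp only [hΦ, norm_mul, RCLike.norm_conj]
      _ ≤ ((K * Real.exp (r / 2 * ∑ i, ‖p.1 i‖ ^ 2)) * (K * Real.exp (r / 2 * ∑ i, ‖p.2 i‖ ^ 2))) *
          ((K * Real.exp (r / 2 * ∑ i, ‖mix Γ p.1 p.2 i‖ ^ 2)) *
            (K * Real.exp (r / 2 * ∑ i, ‖mix Γ p.2 p.1 i‖ ^ 2))) :=
          mul_le_mul (mul_le_mul (hb _) (hb _) (norm_nonneg _) (hK _))
            (mul_le_mul (hb _) (hb _) (norm_nonneg _) (hK _)) (by positivity)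
            (mul_nonneg (hK _) (hK _))
      _ = K ^ 4 * (Real.exp (r / 2 * ∑ i, ‖p.1 i‖ ^ 2) * Real.exp (r / 2 * ∑ i, ‖p.2 i‖ ^ 2) *
          Real.exp (r / 2 * ∑ i, ‖mix Γ p.1 p.2 i‖ ^ 2) *
            Real.exp (r / 2 * ∑ i, ‖mix Γ p.2 p.1 i‖ ^ 2)) := by ring
      _ = K ^ 4 * (Real.exp (r * ∑ i, ‖p.1 i‖ ^ 2) * Real.exp (r * ∑ i, ‖p.2 i‖ ^ 2)) := by
          rw [← Real.exp_add, ← Real.exp_add, ← Real.exp_add, ← Real.exp_add]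
          congr 2
          linear_combination (r / 2) * sum_norm_sq_mix Γ p.1 p.2
  refine ⟨hint, ?_⟩
  have hm := ((measurePreserving_glue Γ).prod (measurePreserving_glue Γ)).comp
    (measurePreserving_prodProdProdComm (bargmannMeasure {i // i ∈ Γ}) (bargmannMeasure {i // i ∈ Γ})
      (bargmannMeasure {i // i ∉ Γ}) (bargmannMeasure {i // i ∉ Γ}))
  have hint2 := hm.integrable_comp_of_integrable hint
  have hinner : ∀ q : ({i // i ∈ Γ} → ℂ) × ({i // i ∈ Γ} → ℂ),
      ∫ y : ({i // i ∉ Γ} → ℂ) × ({i // i ∉ Γ} → ℂ), Φ (glue Γ q.1 y.1, glue Γ q.2 y.2)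
        ∂((bargmannMeasure {i // i ∉ Γ}).prod (bargmannMeasure {i // i ∉ Γ})) =
      reducedDensity Γ F q.1 q.2 * reducedDensity Γ F q.2 q.1 := by
    intro q
    unfold reducedDensity
    rw [← integral_prod_mul]
    congr 1
    ext y
    simp only [hΦ, mix_glue, map_mul]
    ring
  rw [← hm.map_eq, integral_map hm.measurable.aemeasurable
    (by rw [hm.map_eq]; exact hint.aestronglyMeasurable)]
  refine Eq.symm ((integral_prod _ hint2).trans ?_)
  have h3 := hint2.integral_prod_left
  unfold traceSq
  refine Eq.trans ?_ ((integral_prod _ h3).trans ?_)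
  · rfl
  · exact congrArg _ (funext fun z => congrArg _ (funext fun w => hinner (z, w)))

/-- For a state whose square is invariant under the balanced beam splitter, `Tr ρ²` is the squared
norm times the expectation of the parity of the modes in `Γ`. -/
theorem traceSq_reducedDensity_eq_mul (Γ : Finset ι) {F : (ι → ℂ) → ℂ} (hF : Continuous F)
    {K r : ℝ} (hr : r < 1) (hb : ∀ x, ‖F x‖ ≤ K * Real.exp (r / 2 * ∑ i, ‖x i‖ ^ 2)) {κ : ℂ}
    (hκ : κ * κ = 1 / 2) (hκs : star κ = κ)
    (hrot : ∀ p q, F (κ • p + κ • q) * F (κ • p + (-κ) • q) = F p * F q) :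
    traceSq (reducedDensity Γ F) =
      (∫ x, F x * (starRingEnd ℂ) (F x) ∂(bargmannMeasure ι)) *
      (∫ x, F x * (starRingEnd ℂ) (F (parity Γ *ᵥ x)) ∂(bargmannMeasure ι)) := by
  obtain ⟨hint, h⟩ := traceSq_reducedDensity_eq_integral_mix Γ hF hr hb
  have hmp := measurePreserving_bargmann_prod_rotation (ι := ι) (α := κ) (β := κ)
    (γ := κ) (δ := -κ)
    (by rw [hκs]; linear_combination 2 * hκ)
    (by rw [star_neg, hκs]; linear_combination 2 * hκ)
    (by rw [star_neg, hκs]; ring)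
  rw [h, ← integral_prod_mul, ← hmp.map_eq, integral_map hmp.measurable.aemeasurable
    (by rw [hmp.map_eq]; exact hint.aestronglyMeasurable), hmp.map_eq]
  congr 1
  -- After the beam splitter (p + q)/√2, (p - q)/√2, exchanging the Γ coordinates of the two outputs
  -- changes the sign of q on Γ and leaves p alone.
  ext p
  have e1 : mix Γ (κ • p.1 + κ • p.2) (κ • p.1 + (-κ) • p.2) =
      κ • p.1 + (-κ) • (parity Γ *ᵥ p.2) := by
    ext i
    by_cases hi : i ∈ Γ <;> simp [mix, parity, mulVec_diagonal, hi]
  have e2 : mix Γ (κ • p.1 + (-κ) • p.2) (κ • p.1 + κ • p.2) =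
      κ • p.1 + κ • (parity Γ *ᵥ p.2) := by
    ext i
    by_cases hi : i ∈ Γ <;> simp [mix, parity, mulVec_diagonal, hi]
  simp only
  rw [e1, e2, mul_comm (F (κ • p.1 + (-κ) • _)), hrot, hrot, map_mul]
  ring

/-- The kernel is Hermitian, so Tr ρ² is ∫∫ |ρ(z, w)|² ≥ 0. Hence moduli of its powers determine the
entropy, and no branch of a square root has to be chosen. -/
theorem traceSq_re_eq_norm (Γ : Finset ι) (F : (ι → ℂ) → ℂ) :
    (traceSq (reducedDensity Γ F)).re = ‖traceSq (reducedDensity Γ F)‖ := by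
  have hsymm : ∀ z w, reducedDensity Γ F w z = (starRingEnd ℂ) (reducedDensity Γ F z w) := by
    intro z w
    unfold reducedDensity
    rw [← integral_conj]
    congr 1
    ext y
    simp [mul_comm]
  have h : traceSq (reducedDensity Γ F) = ((∫ z, ∫ w, ‖reducedDensity Γ F z w‖ ^ 2
      ∂(bargmannMeasure {i // i ∈ Γ}) ∂(bargmannMeasure {i // i ∈ Γ}) : ℝ) : ℂ) := by
    unfold traceSq
    rw [← integral_complex_ofReal]
    congr 1
    ext z
    rw [← integral_complex_ofReal]
    congr 1
    ext w
    rw [hsymm z w, Complex.mul_conj, Complex.normSq_eq_norm_sq]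
  rw [h, Complex.ofReal_re, Complex.norm_real, Real.norm_of_nonneg]
  positivity

end

section

/-! ### The Rényi-2 entropy in terms of eigenvalues -/

variable {ι : Type} [Fintype ι] [DecidableEq ι]

theorem parity_mul_self (Γ : Finset ι) : parity Γ * parity Γ = 1 := by
  rw [parity, diagonal_mul_diagonal, ← diagonal_one]
  congr 1
  ext i
  by_cases h : i ∈ Γ <;> simp [h]

omit [Fintype ι] in
theorem parity_transpose (Γ : Finset ι) : (parity Γ)ᵀ = parity Γ := diagonal_transpose _

omit [Fintype ι] in
theorem parity_conjTranspose (Γ : Finset ι) : (parity Γ)ᴴ = parity Γ := by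
  rw [parity, diagonal_conjTranspose]
  congr 1
  ext i
  by_cases h : i ∈ Γ <;> simp [h]

-- The exponent is ∑ ((Uᵀz)ᵢ)² = zᵀ U Uᵀ z, so apart from the prefactor only U Uᵀ matters.
omit [DecidableEq ι] in
theorem passiveUnitary_squeezedVacuum (U : Matrix ι ι ℂ) (s : ℝ) (z : ι → ℂ) :
    passiveUnitary U (squeezedVacuum s) z =
      (((Real.sqrt (Real.cosh s))⁻¹ : ℝ) : ℂ) ^ Fintype.card ι *
        Complex.exp ((Real.tanh s : ℂ) / 2 * (z ⬝ᵥ (U * Uᵀ) *ᵥ z)) := by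
  unfold passiveUnitary squeezedVacuum
  rw [Finset.prod_mul_distrib, Finset.prod_const, ← Complex.exp_sum, ← Finset.mul_sum,
    Finset.card_univ]
  congr 3
  rw [← mulVec_mulVec, dotProduct_mulVec, ← mulVec_transpose, dotProduct]
  exact Finset.sum_congr rfl fun i _ => sq _

theorem norm_one_sub_mul_sq {d : ℂ} (hd : ‖d‖ = 1) (r : ℝ) :
    ‖1 - r * d‖ ^ 2 = (1 - r) ^ 2 + r * ‖1 - d‖ ^ 2 := by
  have h : d.re ^ 2 + d.im ^ 2 = 1 := by
    have := Complex.normSq_eq_norm_sq d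
    rw [hd, Complex.normSq_apply] at this
    linarith
  rw [← Complex.normSq_eq_norm_sq, ← Complex.normSq_eq_norm_sq, Complex.normSq_apply,
    Complex.normSq_apply]
  simp
  linear_combination (r ^ 2 - r) * h

theorem tanh_sq_div (s : ℝ) :
    Real.tanh s ^ 2 / (1 - Real.tanh s ^ 2) ^ 2 = Real.sinh (2 * s) ^ 2 / 4 := by
  have h1 : Real.cosh s ≠ 0 := (Real.cosh_pos s).ne'
  have h2 : 1 - Real.tanh s ^ 2 = (Real.cosh s ^ 2)⁻¹ := by
    rw [Real.tanh_eq_sinh_div_cosh]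
    field_simp
    linarith [Real.cosh_sq s]
  rw [h2, Real.sinh_two_mul, Real.tanh_eq_sinh_div_cosh]
  field_simp
  ring

theorem one_sub_tanh_sq (s : ℝ) : 1 - Real.tanh s ^ 2 = ((Real.sqrt (Real.cosh s))⁻¹) ^ 4 := by
  have h1 : 0 < Real.cosh s := Real.cosh_pos s
  rw [inv_pow, show (4 : ℕ) = 2 * 2 from rfl, pow_mul, Real.sq_sqrt h1.le,
    Real.tanh_eq_sinh_div_cosh]
  field_simp
  linarith [Real.cosh_sq s]

theorem unitary_mul_transpose {U : Matrix ι ι ℂ} (hU : U * Uᴴ = 1) :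
    (U * Uᵀ) * (U * Uᵀ)ᴴ = 1 := by
  have h1 : Uᵀ * (Uᵀ)ᴴ = 1 := by
    have := congrArg transpose (mul_eq_one_comm.mp hU)
    rw [transpose_mul, transpose_one] at this
    exact this
  rw [conjTranspose_mul]
  calc U * Uᵀ * ((Uᵀ)ᴴ * Uᴴ) = U * (Uᵀ * (Uᵀ)ᴴ) * Uᴴ := by noncomm_ring
    _ = 1 := by rw [h1, mul_one, hU]

theorem unitary_parity_conj {A : Matrix ι ι ℂ} (hA : A * Aᴴ = 1) (Γ : Finset ι) :
    (parity Γ * A * parity Γ) * (parity Γ * A * parity Γ)ᴴ = 1 := by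
  rw [conjTranspose_mul, conjTranspose_mul, parity_conjTranspose]
  calc parity Γ * A * parity Γ * (parity Γ * (Aᴴ * parity Γ))
      = parity Γ * (A * (parity Γ * parity Γ) * Aᴴ) * parity Γ := by noncomm_ring
    _ = 1 := by rw [parity_mul_self, mul_one, hA, mul_one, parity_mul_self]

/-- The Rényi-2 entropy in terms of the eigenvalues of `(D A D)ᴴ A`, where `A = U Uᵀ` and `D` is the
parity of the subsystem. -/
theorem renyi2_eq_sum_log {s : ℝ} (hs : 0 < s) (Γ : Finset ι) {U W : Matrix ι ι ℂ} {d : ι → ℂ}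
    (hU : U * Uᴴ = 1) (hW : W * Wᴴ = 1)
    (hd : (parity Γ * (U * Uᵀ) * parity Γ)ᴴ * (U * Uᵀ) = W * diagonal d * Wᴴ) :
    renyi2 s Γ U = (∑ i, Real.log (1 + Real.sinh (2 * s) ^ 2 / 4 * ‖1 - d i‖ ^ 2)) / 4 := by
  have hA := unitary_mul_transpose hU
  have hAs : (U * Uᵀ)ᵀ = U * Uᵀ := by rw [transpose_mul, transpose_transpose]
  have hFz := passiveUnitary_squeezedVacuum U s
  have hct := one_sub_tanh_sq s
  have hc0 : 0 < (Real.sqrt (Real.cosh s))⁻¹ := inv_pos.mpr (Real.sqrt_pos.mpr (Real.cosh_pos s))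
  generalize U * Uᵀ = A at *
  generalize (Real.sqrt (Real.cosh s))⁻¹ = c at *
  set t := Real.tanh s with ht
  set n := Fintype.card ι with hn
  have ht0 : 0 ≤ t := by
    rw [ht, Real.tanh_eq_sinh_div_cosh]
    exact div_nonneg (Real.sinh_nonneg_iff.mpr hs.le) (Real.cosh_pos s).le
  have ht1 : t < 1 := Real.tanh_lt_one s
  have ht2 : t ^ 2 < 1 := by nlinarith
  set F := passiveUnitary U (squeezedVacuum s) with hF
  have hB := unitary_parity_conj hA Γ
  have hBs : (parity Γ * A * parity Γ)ᵀ = parity Γ * A * parity Γ := by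
    rw [transpose_mul, transpose_mul, hAs, parity_transpose, mul_assoc]
  have hq : ∀ z : ι → ℂ, (parity Γ *ᵥ z) ⬝ᵥ A *ᵥ (parity Γ *ᵥ z) =
      z ⬝ᵥ (parity Γ * A * parity Γ) *ᵥ z := by
    intro z
    rw [← mulVec_mulVec, ← mulVec_mulVec, dotProduct_mulVec z, ← mulVec_transpose,
      parity_transpose]
  generalize parity Γ * A * parity Γ = B at *
  have hFc : Continuous F := by
    have : F = fun z => (c : ℂ) ^ n * Complex.exp ((t : ℂ) / 2 * (z ⬝ᵥ A *ᵥ z)) := funext hFz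
    rw [this]
    have := continuous_quadratic A
    fun_prop
  have hb : ∀ x, ‖F x‖ ≤ c ^ n * Real.exp (t / 2 * ∑ i, ‖x i‖ ^ 2) := by
    intro x
    rw [hFz, norm_mul, norm_pow, Complex.norm_real, Real.norm_of_nonneg hc0.le, Complex.norm_exp]
    refine mul_le_mul_of_nonneg_left (Real.exp_le_exp.mpr ((Complex.re_le_norm _).trans ?_))
      (by positivity)
    rw [norm_mul]
    have : ‖(t / 2 : ℂ)‖ = t / 2 := by
      rw [norm_div, Complex.norm_real, Real.norm_of_nonneg ht0]; simp
    rw [this]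
    exact mul_le_mul_of_nonneg_left (norm_quadratic_le hA x) (by positivity)
  set κ : ℂ := (((Real.sqrt 2)⁻¹ : ℝ) : ℂ) with hκ
  have hκ2 : κ * κ = 1 / 2 := by
    rw [hκ, ← Complex.ofReal_mul, ← mul_inv, Real.mul_self_sqrt (by norm_num)]; simp
  have hκs : star κ = κ := by rw [hκ, Complex.star_def, Complex.conj_ofReal]
  have hrot : ∀ p q, F (κ • p + κ • q) * F (κ • p + (-κ) • q) = F p * F q := by
    intro p q
    have hm : ∀ a x y : ℂ, a * x * (a * y) = a ^ 2 * (x * y) := fun a x y => by ring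
    rw [hFz, hFz, hFz, hFz, hm, hm, ← Complex.exp_add, ← Complex.exp_add]
    congr 2
    simp only [mulVec_add, mulVec_smul, dotProduct_add, add_dotProduct, dotProduct_smul,
      smul_dotProduct, smul_eq_mul]
    linear_combination ((t : ℂ) * (p ⬝ᵥ A *ᵥ p) + t * (q ⬝ᵥ A *ᵥ q)) * hκ2
  have htr := traceSq_reducedDensity_eq_mul Γ hFc ht1 hb hκ2 hκs hrot
  have hJ1 : ∫ x, F x * (starRingEnd ℂ) (F x) ∂(bargmannMeasure ι) = (c : ℂ) ^ (2 * n) *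
      ∫ z : ι → ℂ, Complex.exp (t / 2 * (z ⬝ᵥ A *ᵥ z) + t / 2 * star (z ⬝ᵥ A *ᵥ z))
        ∂(bargmannMeasure ι) := by
    rw [← integral_const_mul]
    congr 1
    ext z
    rw [hFz, Complex.exp_add, map_mul, map_pow, Complex.conj_ofReal, ← Complex.exp_conj, map_mul,
      map_div₀, Complex.conj_ofReal, map_ofNat, Complex.star_def]
    ring
  have hJ2 : ∫ x, F x * (starRingEnd ℂ) (F (parity Γ *ᵥ x)) ∂(bargmannMeasure ι) =
      (c : ℂ) ^ (2 * n) *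
      ∫ z : ι → ℂ, Complex.exp (t / 2 * (z ⬝ᵥ A *ᵥ z) + t / 2 * star (z ⬝ᵥ B *ᵥ z))
        ∂(bargmannMeasure ι) := by
    rw [← integral_const_mul]
    congr 1
    ext z
    rw [hFz, hFz, hq, Complex.exp_add, map_mul, map_pow, Complex.conj_ofReal, ← Complex.exp_conj,
      map_mul, map_div₀, Complex.conj_ofReal, map_ofNat, Complex.star_def]
    ring
  have hA2 : Aᴴ * A = 1 * diagonal (fun _ => (1 : ℂ)) * 1ᴴ := by
    rw [mul_eq_one_comm.mp hA]; simp
  have hS1 := integral_gaussian_quadratic_sq hA hA hAs hAs (by simp) hA2 ht0 ht1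
  have hS2 := integral_gaussian_quadratic_sq hA hB hAs hBs hW hd ht0 ht1
  have hV : (Bᴴ * A) * (Bᴴ * A)ᴴ = 1 := by
    rw [conjTranspose_mul, conjTranspose_conjTranspose, mul_assoc, ← mul_assoc A, hA, one_mul,
      mul_eq_one_comm.mp hB]
  have hdn := norm_eq_one_of_diagonalization hV hW hd
  -- The prefactors give c^(8n). The norm integral squared is (1 - t²)^(-n) = c^(-4n), which leaves
  -- one factor c⁴ per eigenvalue.
  have hsq : traceSq (reducedDensity Γ F) ^ 2 = ∏ i, ((c : ℂ) ^ 4 * (1 - (t : ℂ) ^ 2 * d i)⁻¹) := by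
    rw [htr, hJ1, hJ2]
    have hct' : (1 : ℂ) - (t : ℂ) ^ 2 * 1 = (c : ℂ) ^ 4 := by
      rw [mul_one]; exact_mod_cast hct
    have hcc : (c : ℂ) ≠ 0 := by exact_mod_cast hc0.ne'
    rw [Finset.prod_mul_distrib, Finset.prod_const, Finset.card_univ, ← hn, Finset.prod_inv_distrib,
      ← hS2]
    calc _ = ((c : ℂ) ^ 4) ^ (2 * n) * (∫ z : ι → ℂ, Complex.exp (t / 2 * (z ⬝ᵥ A *ᵥ z) +
            t / 2 * star (z ⬝ᵥ A *ᵥ z)) ∂(bargmannMeasure ι)) ^ 2 *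
          (∫ z : ι → ℂ, Complex.exp (t / 2 * (z ⬝ᵥ A *ᵥ z) +
            t / 2 * star (z ⬝ᵥ B *ᵥ z)) ∂(bargmannMeasure ι)) ^ 2 := by ring
      _ = _ := by
        rw [hS1, hct', Finset.prod_const, Finset.card_univ, ← hn, two_mul n, pow_add,
          mul_inv_cancel_right₀ (pow_ne_zero _ (pow_ne_zero _ hcc))]
  have hterm : ∀ i, ‖(c : ℂ) ^ 4 * (1 - (t : ℂ) ^ 2 * d i)⁻¹‖ ^ 2 =
      (1 + Real.sinh (2 * s) ^ 2 / 4 * ‖1 - d i‖ ^ 2)⁻¹ := by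
    intro i
    have h1 := norm_one_sub_mul_sq (hdn i) (t ^ 2)
    rw [Complex.ofReal_pow] at h1
    rw [norm_mul, norm_pow, norm_inv, Complex.norm_real, Real.norm_of_nonneg hc0.le, mul_pow, inv_pow,
      h1, ← hct, ← tanh_sq_div]
    have : 1 - t ^ 2 ≠ 0 := by linarith
    rw [← ht]
    have h2 : 0 < (1 - t ^ 2) ^ 2 + t ^ 2 * ‖1 - d i‖ ^ 2 := by positivity
    field_simp
  -- One squaring removes the square root of the determinant, the other comes from |1 - t² dᵢ|²;
  -- together they give the 1/4 in front of the sum.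
  have hfour : (traceSq (reducedDensity Γ F)).re ^ 4 =
      ∏ i, (1 + Real.sinh (2 * s) ^ 2 / 4 * ‖1 - d i‖ ^ 2)⁻¹ := by
    rw [traceSq_re_eq_norm, show (4 : ℕ) = 2 * 2 from rfl, pow_mul, ← norm_pow, hsq, norm_prod,
      ← Finset.prod_pow]
    exact Finset.prod_congr rfl fun i _ => hterm i
  have hlog := congrArg Real.log hfour
  rw [Real.log_pow, Real.log_prod (fun i _ => by positivity)] at hlog
  simp_rw [Real.log_inv] at hlog
  rw [Finset.sum_neg_distrib] at hlog
  unfold renyi2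
  push_cast at hlog
  linarith

end

section

/-! ### Bounds on the Rényi-2 entropy -/

variable {ι : Type} [Fintype ι]

/-- The squared Frobenius norm of a matrix. -/
def frobSq (M : Matrix ι ι ℂ) : ℝ := ∑ i, ∑ j, ‖M i j‖ ^ 2

theorem frobSq_transpose (M : Matrix ι ι ℂ) : frobSq Mᵀ = frobSq M := Finset.sum_comm

theorem frobSq_add_le (M N : Matrix ι ι ℂ) : frobSq (M + N) ≤ 2 * frobSq M + 2 * frobSq N := by
  unfold frobSq
  simp only [Finset.mul_sum, ← Finset.sum_add_distrib]
  refine Finset.sum_le_sum fun i _ => Finset.sum_le_sum fun j _ => ?_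
  have h := norm_add_le (M i j) (N i j)
  have h0 := norm_nonneg (M i j + N i j)
  rw [Matrix.add_apply]
  nlinarith [sq_nonneg (‖M i j‖ - ‖N i j‖)]

variable [DecidableEq ι]

theorem frobSq_unitary_mul {Q : Matrix ι ι ℂ} (hQ : Q * Qᴴ = 1) (M : Matrix ι ι ℂ) :
    frobSq (Q * M) = frobSq M := by
  rw [← frobSq_transpose, ← frobSq_transpose M]
  exact Finset.sum_congr rfl fun j _ => sum_norm_sq_mulVec (mul_eq_one_comm.mp hQ) fun k => M k j

theorem unitary_transpose {Q : Matrix ι ι ℂ} (hQ : Q * Qᴴ = 1) : Qᵀ * (Qᵀ)ᴴ = 1 := by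
  have := congrArg transpose (mul_eq_one_comm.mp hQ)
  rw [transpose_mul, transpose_one] at this
  exact this

theorem frobSq_mul_unitary {Q : Matrix ι ι ℂ} (hQ : Q * Qᴴ = 1) (M : Matrix ι ι ℂ) :
    frobSq (M * Q) = frobSq M := by
  rw [← frobSq_transpose, transpose_mul, frobSq_unitary_mul (unitary_transpose hQ), frobSq_transpose]

theorem unitary_mul {P Q : Matrix ι ι ℂ} (hP : P * Pᴴ = 1) (hQ : Q * Qᴴ = 1) :
    (P * Q) * (P * Q)ᴴ = 1 := by
  rw [conjTranspose_mul, mul_assoc, ← mul_assoc Q, hQ, one_mul, hP]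

theorem unitary_conjTranspose {Q : Matrix ι ι ℂ} (hQ : Q * Qᴴ = 1) : Qᴴ * (Qᴴ)ᴴ = 1 := by
  rw [conjTranspose_conjTranspose]; exact mul_eq_one_comm.mp hQ

/-- The commutator of a matrix with the parity of `Γ`. -/
def parityComm (Γ : Finset ι) (M : Matrix ι ι ℂ) : Matrix ι ι ℂ := M * parity Γ - parity Γ * M

/-- The Leibniz rule makes both the rank and, for unitary factors, the Frobenius norm of the
commutator subadditive along a product. -/
theorem parityComm_mul (Γ : Finset ι) (M N : Matrix ι ι ℂ) :
    parityComm Γ (M * N) = M * parityComm Γ N + parityComm Γ M * N := by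
  unfold parityComm; noncomm_ring

theorem parityComm_one (Γ : Finset ι) : parityComm Γ 1 = 0 := by simp [parityComm]

theorem parityComm_transpose (Γ : Finset ι) (M : Matrix ι ι ℂ) :
    parityComm Γ Mᵀ = -(parityComm Γ M)ᵀ := by
  unfold parityComm
  rw [transpose_sub, transpose_mul, transpose_mul, parity_transpose, neg_sub]

omit [DecidableEq ι] in
theorem rank_matrix_add_le (M N : Matrix ι ι ℂ) : (M + N).rank ≤ M.rank + N.rank := by
  unfold Matrix.rank
  refine le_trans (Submodule.finrank_mono ?_) (Submodule.finrank_add_le_finrank_add_finrank _ _)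
  rw [mulVecLin_add]
  exact LinearMap.range_add_le _ _

theorem rank_parityComm_mul_le (Γ : Finset ι) (M N : Matrix ι ι ℂ) :
    (parityComm Γ (M * N)).rank ≤ (parityComm Γ M).rank + (parityComm Γ N).rank := by
  rw [parityComm_mul, add_comm (parityComm Γ M).rank]
  exact (rank_matrix_add_le _ _).trans
    (add_le_add (rank_mul_le_right _ _) (rank_mul_le_left _ _))

theorem rank_parityComm_transpose (Γ : Finset ι) (M : Matrix ι ι ℂ) :
    (parityComm Γ Mᵀ).rank = (parityComm Γ M).rank := by
  rw [parityComm_transpose, ← rank_transpose (parityComm Γ M)]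
  unfold Matrix.rank
  have : (-(parityComm Γ M)ᵀ).mulVecLin = -(parityComm Γ M)ᵀ.mulVecLin := by
    ext v; simp
  rw [this, LinearMap.range_neg]

omit [DecidableEq ι] in
theorem frobSq_neg (M : Matrix ι ι ℂ) : frobSq (-M) = frobSq M := by
  simp [frobSq]

theorem frobSq_parityComm_mul_transpose_le (Γ : Finset ι) {U : Matrix ι ι ℂ} (hU : U * Uᴴ = 1) :
    frobSq (parityComm Γ (U * Uᵀ)) ≤ 4 * frobSq (parityComm Γ U) := by
  rw [parityComm_mul]
  refine (frobSq_add_le _ _).trans ?_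
  rw [frobSq_unitary_mul hU, frobSq_mul_unitary (unitary_transpose hU), parityComm_transpose,
    frobSq_neg, frobSq_transpose]
  linarith

/-- The commutator kills the entries inside the two diagonal blocks and multiplies the entries
connecting Γ to its complement by ±2. -/
theorem frobSq_parityComm (Γ : Finset ι) (M : Matrix ι ι ℂ) :
    frobSq (parityComm Γ M) =
      4 * ∑ x, ∑ y, if (x ∈ Γ ↔ y ∈ Γ) then 0 else ‖M x y‖ ^ 2 := by
  simp only [frobSq, Finset.mul_sum]
  refine Finset.sum_congr rfl fun x _ => Finset.sum_congr rfl fun y _ => ?_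
  have h2 : ∀ a : ℂ, ‖a + a‖ ^ 2 = 4 * ‖a‖ ^ 2 := by
    intro a
    rw [← two_mul, norm_mul, mul_pow]
    norm_num
  have h3 : ∀ a : ℂ, ‖-a - a‖ ^ 2 = 4 * ‖a‖ ^ 2 := by
    intro a
    rw [← h2, ← norm_neg]
    congr 2
    ring
  by_cases hx : x ∈ Γ <;> by_cases hy : y ∈ Γ <;>
    simp [parityComm, parity, hx, hy, h2, h3]

/-- With B = DAD unitary, 1 - BᴴA = Bᴴ(B - A), and B - A = D[A, D] since D² = 1. The prefactor BᴴD
is unitary, so rank and Frobenius norm pass to the commutator. -/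
theorem one_sub_parity_conj_mul {A : Matrix ι ι ℂ} (hA : A * Aᴴ = 1) (Γ : Finset ι) :
    1 - (parity Γ * A * parity Γ)ᴴ * A =
      ((parity Γ * A * parity Γ)ᴴ * parity Γ) * parityComm Γ A := by
  have hB := mul_eq_one_comm.mp (unitary_parity_conj hA Γ)
  have h : parity Γ * parityComm Γ A = parity Γ * A * parity Γ - A := by
    unfold parityComm
    calc parity Γ * (A * parity Γ - parity Γ * A)
        = parity Γ * A * parity Γ - (parity Γ * parity Γ) * A := by noncomm_ring
      _ = _ := by rw [parity_mul_self, one_mul]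
  rw [mul_assoc _ (parity Γ) (parityComm Γ A), h, mul_sub, hB]

theorem one_sub_diagonalization {V W : Matrix ι ι ℂ} {d : ι → ℂ}
    (hW : W * Wᴴ = 1) (hd : V = W * diagonal d * Wᴴ) :
    1 - V = W * diagonal (fun i => 1 - d i) * Wᴴ := by
  have h7 : (diagonal fun i => 1 - d i) = 1 - diagonal d := by
    ext i j
    by_cases hij : i = j
    · subst hij; simp
    · simp [hij]
  rw [h7, hd, mul_sub, sub_mul, mul_one, hW]

theorem frobSq_diagonal (d : ι → ℂ) : frobSq (diagonal d) = ∑ i, ‖d i‖ ^ 2 := by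
  unfold frobSq
  refine Finset.sum_congr rfl fun i _ => ?_
  rw [Finset.sum_eq_single i (fun j _ hj => by simp [diagonal_apply_ne _ hj.symm]) (by simp)]
  simp

/-- Diagonalization data behind the Rényi-2 entropy. -/
theorem exists_eigenvalues_renyi2 {s : ℝ} (hs : 0 < s) (Γ : Finset ι) {U : Matrix ι ι ℂ}
    (hU : U * Uᴴ = 1) :
    ∃ d : ι → ℂ, (∀ i, ‖d i‖ = 1) ∧
      renyi2 s Γ U = (∑ i, Real.log (1 + Real.sinh (2 * s) ^ 2 / 4 * ‖1 - d i‖ ^ 2)) / 4 ∧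
      ∑ i, ‖1 - d i‖ ^ 2 = frobSq (parityComm Γ (U * Uᵀ)) ∧
      (Finset.univ.filter fun i => d i ≠ 1).card ≤ (parityComm Γ (U * Uᵀ)).rank := by
  have hA := unitary_mul_transpose hU
  have hB := unitary_parity_conj hA Γ
  set A := U * Uᵀ with hAdef
  have hV : ((parity Γ * A * parity Γ)ᴴ * A) * ((parity Γ * A * parity Γ)ᴴ * A)ᴴ = 1 :=
    unitary_mul (unitary_conjTranspose hB) hA
  obtain ⟨W, d, hW, hd⟩ := exists_unitary_diagonalization hV
  have hW2 : Wᴴ * W = 1 := mul_eq_one_comm.mp hW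
  have h1 := one_sub_diagonalization hW hd
  rw [one_sub_parity_conj_mul hA] at h1
  have hQ : ((parity Γ * A * parity Γ)ᴴ * parity Γ) *
      ((parity Γ * A * parity Γ)ᴴ * parity Γ)ᴴ = 1 :=
    unitary_mul (unitary_conjTranspose hB) (by rw [parity_conjTranspose, parity_mul_self])
  refine ⟨d, norm_eq_one_of_diagonalization hV hW hd, renyi2_eq_sum_log hs Γ hU hW hd, ?_, ?_⟩
  · rw [← frobSq_diagonal fun i => 1 - d i, ← frobSq_unitary_mul hQ (parityComm Γ A), h1,
      frobSq_mul_unitary (unitary_conjTranspose hW), frobSq_unitary_mul hW]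
  · have h2 : diagonal (fun i => 1 - d i) = Wᴴ * ((((parity Γ * A * parity Γ)ᴴ * parity Γ) *
        parityComm Γ A) * W) := by
      rw [h1]
      calc diagonal (fun i => 1 - d i) = (Wᴴ * W) * diagonal (fun i => 1 - d i) * (Wᴴ * W) := by
            rw [hW2]; simp
        _ = _ := by noncomm_ring
    have h3 : (diagonal fun i => 1 - d i).rank ≤ (parityComm Γ A).rank := by
      rw [h2]
      exact (rank_mul_le_right _ _).trans ((rank_mul_le_left _ _).trans (rank_mul_le_right _ _))
    rw [rank_diagonal, Fintype.card_subtype] at h3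
    refine le_trans (Finset.card_le_card fun i => ?_) h3
    simp only [Finset.mem_filter, Finset.mem_univ, true_and, ne_eq, sub_eq_zero]
    exact fun h h' => h h'.symm

theorem renyi2_nonneg {s : ℝ} (hs : 0 < s) (Γ : Finset ι) {U : Matrix ι ι ℂ} (hU : U * Uᴴ = 1) :
    0 ≤ renyi2 s Γ U := by
  obtain ⟨d, -, h, -, -⟩ := exists_eigenvalues_renyi2 hs Γ hU
  rw [h]
  refine div_nonneg (Finset.sum_nonneg fun i _ => Real.log_nonneg ?_) (by norm_num)
  have : 0 ≤ Real.sinh (2 * s) ^ 2 / 4 * ‖1 - d i‖ ^ 2 := by positivity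
  linarith

theorem renyi2_le_rank {s : ℝ} (hs : 0 < s) (Γ : Finset ι) {U : Matrix ι ι ℂ} (hU : U * Uᴴ = 1) :
    renyi2 s Γ U ≤ (parityComm Γ (U * Uᵀ)).rank * Real.log (Real.cosh (2 * s)) / 2 := by
  obtain ⟨d, hd, h, -, hr⟩ := exists_eigenvalues_renyi2 hs Γ hU
  have hlog : 0 ≤ Real.log (Real.cosh (2 * s)) := Real.log_nonneg (Real.one_le_cosh _)
  have hterm : ∀ i, Real.log (1 + Real.sinh (2 * s) ^ 2 / 4 * ‖1 - d i‖ ^ 2) ≤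
      if d i ≠ 1 then 2 * Real.log (Real.cosh (2 * s)) else 0 := by
    intro i
    by_cases hi : d i = 1
    · simp [hi]
    · rw [if_pos hi]
      have h2 : ‖1 - d i‖ ≤ 2 := by
        refine (norm_sub_le _ _).trans ?_
        rw [hd i, norm_one]; norm_num
      have h3 : ‖1 - d i‖ ^ 2 ≤ 4 := by nlinarith [norm_nonneg (1 - d i)]
      -- At the extreme |1 - dᵢ| = 2 the argument is 1 + sinh² = cosh².
      calc _ ≤ Real.log (Real.cosh (2 * s) ^ 2) := by
            refine Real.log_le_log (by positivity) ?_
            rw [Real.cosh_sq]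
            nlinarith [sq_nonneg (Real.sinh (2 * s))]
        _ = _ := by rw [Real.log_pow]; norm_num
  rw [h]
  have h4 := Finset.sum_le_sum fun i (_ : i ∈ Finset.univ) => hterm i
  rw [← Finset.sum_filter, Finset.sum_const, nsmul_eq_mul] at h4
  have h5 : ((Finset.univ.filter fun i => d i ≠ 1).card : ℝ) ≤ (parityComm Γ (U * Uᵀ)).rank := by
    exact_mod_cast hr
  nlinarith

theorem renyi2_le_sum_norm_sq {s : ℝ} (hs : 0 < s) (Γ : Finset ι) {U : Matrix ι ι ℂ}
    (hU : U * Uᴴ = 1) :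
    renyi2 s Γ U ≤ Real.sinh (2 * s) ^ 2 *
      ∑ x, ∑ y, if (x ∈ Γ ↔ y ∈ Γ) then 0 else ‖U x y‖ ^ 2 := by
  obtain ⟨d, -, h, hf, -⟩ := exists_eigenvalues_renyi2 hs Γ hU
  have h1 : ∑ i, Real.log (1 + Real.sinh (2 * s) ^ 2 / 4 * ‖1 - d i‖ ^ 2) ≤
      Real.sinh (2 * s) ^ 2 / 4 * ∑ i, ‖1 - d i‖ ^ 2 := by
    rw [Finset.mul_sum]
    refine Finset.sum_le_sum fun i _ => ?_
    have h0 : 0 ≤ Real.sinh (2 * s) ^ 2 / 4 * ‖1 - d i‖ ^ 2 := by positivity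
    linarith [Real.log_le_sub_one_of_pos
      (show 0 < 1 + Real.sinh (2 * s) ^ 2 / 4 * ‖1 - d i‖ ^ 2 by linarith)]
  have h2 := frobSq_parityComm_mul_transpose_le Γ hU
  rw [frobSq_parityComm Γ U] at h2
  rw [hf] at h1
  rw [h]
  nlinarith [sq_nonneg (Real.sinh (2 * s))]

end

section

/-! ### Brickwall circuits and the worst-case bound -/

variable {m : ℕ}

/-- Reduces the layer to a single gate on its own pair of modes; both unitarity and the Haar average
then become statements about one gate. -/
theorem leftLayer_mulVec (u : Fin m → Matrix.unitaryGroup (Fin 2) ℂ) (v : Fin (2 * m) → ℂ)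
    (x : Fin (2 * m)) :
    (leftLayer u *ᵥ v) x = ((u ⟨(x : ℕ) / 2, by omega⟩).1 *ᵥ
      ![v ⟨2 * ((x : ℕ) / 2), by omega⟩, v ⟨2 * ((x : ℕ) / 2) + 1, by omega⟩])
      ⟨(x : ℕ) % 2, by omega⟩ := by
  have hx := x.2
  rw [mulVec, dotProduct, Fintype.sum_eq_add (⟨2 * ((x : ℕ) / 2), by omega⟩ : Fin (2 * m))
    ⟨2 * ((x : ℕ) / 2) + 1, by omega⟩ (by simp [Fin.ext_iff])]
  · have e1 : 2 * ((x : ℕ) / 2) % 2 = 0 := by omega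
    have e2 : (2 * ((x : ℕ) / 2) + 1) % 2 = 1 := by omega
    have e3 : 2 * ((x : ℕ) / 2) / 2 = (x : ℕ) / 2 := by omega
    have e4 : (2 * ((x : ℕ) / 2) + 1) / 2 = (x : ℕ) / 2 := by omega
    simp [leftLayer, mulVec, dotProduct, Fin.sum_univ_two, e1, e2, e3, e4]
  · rintro z ⟨h1, h2⟩
    have : (x : ℕ) / 2 ≠ (z : ℕ) / 2 := by
      intro h
      simp only [ne_eq, Fin.ext_iff] at h1 h2
      omega
    simp [leftLayer, this]

theorem rightLayer_mulVec_zero (u : Fin (m - 1) → Matrix.unitaryGroup (Fin 2) ℂ)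
    (a b : Matrix.unitaryGroup (Fin 1) ℂ) (v : Fin (2 * m) → ℂ)
    (x : Fin (2 * m)) (hx : (x : ℕ) = 0) :
    (rightLayer u a b *ᵥ v) x = a.1 0 0 * v x := by
  rw [mulVec, dotProduct, Fintype.sum_eq_single x]
  · simp [rightLayer, hx]
  · intro z hz
    have : ((x : ℕ) + 1) / 2 ≠ ((z : ℕ) + 1) / 2 := by
      intro h; apply hz; rw [Fin.ext_iff]; omega
    simp [rightLayer, this]

theorem rightLayer_mulVec_last (u : Fin (m - 1) → Matrix.unitaryGroup (Fin 2) ℂ)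
    (a b : Matrix.unitaryGroup (Fin 1) ℂ) (v : Fin (2 * m) → ℂ)
    (x : Fin (2 * m)) (hx : (x : ℕ) + 1 = 2 * m) :
    (rightLayer u a b *ᵥ v) x = b.1 0 0 * v x := by
  rw [mulVec, dotProduct, Fintype.sum_eq_single x]
  · have : (x : ℕ) ≠ 0 := by omega
    simp [rightLayer, hx, this]
  · intro z hz
    have h2 := z.2
    have : ((x : ℕ) + 1) / 2 ≠ ((z : ℕ) + 1) / 2 := by
      intro h; apply hz; rw [Fin.ext_iff]; omega
    simp only [rightLayer, this, if_false, zero_mul]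

theorem rightLayer_mulVec_inner (u : Fin (m - 1) → Matrix.unitaryGroup (Fin 2) ℂ)
    (a b : Matrix.unitaryGroup (Fin 1) ℂ) (v : Fin (2 * m) → ℂ)
    (x : Fin (2 * m)) (hx : (x : ℕ) ≠ 0) (hx' : (x : ℕ) + 1 ≠ 2 * m) :
    (rightLayer u a b *ᵥ v) x = ((u ⟨((x : ℕ) - 1) / 2, by omega⟩).1 *ᵥ
      ![v ⟨2 * (((x : ℕ) - 1) / 2) + 1, by omega⟩, v ⟨2 * (((x : ℕ) - 1) / 2) + 2, by omega⟩])
      ⟨((x : ℕ) + 1) % 2, by omega⟩ := by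
  have hx2 := x.2
  rw [mulVec, dotProduct, Fintype.sum_eq_add (⟨2 * (((x : ℕ) - 1) / 2) + 1, by omega⟩ : Fin (2 * m))
    ⟨2 * (((x : ℕ) - 1) / 2) + 2, by omega⟩ (by simp [Fin.ext_iff])]
  · have e1 : (2 * (((x : ℕ) - 1) / 2) + 1 + 1) % 2 = 0 := by omega
    have e2 : (2 * (((x : ℕ) - 1) / 2) + 2 + 1) % 2 = 1 := by omega
    have e3 : ((x : ℕ) + 1) / 2 = (2 * (((x : ℕ) - 1) / 2) + 1 + 1) / 2 := by omega
    have e4 : ((x : ℕ) + 1) / 2 = (2 * (((x : ℕ) - 1) / 2) + 2 + 1) / 2 := by omega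
    simp only [rightLayer, hx, hx', ← e3, ← e4, e1, e2, if_true, dite_false, mulVec, dotProduct,
      Fin.sum_univ_two]
    rfl
  · rintro z ⟨h1, h2⟩
    have : ((x : ℕ) + 1) / 2 ≠ ((z : ℕ) + 1) / 2 := by
      intro h
      simp only [ne_eq, Fin.ext_iff] at h1 h2
      omega
    simp [rightLayer, this]

theorem mul_conjTranspose_apply {n : ℕ} (M : Matrix (Fin n) (Fin n) ℂ) (x y : Fin n) :
    (M * Mᴴ) x y = (M *ᵥ fun z => star (M y z)) x := rfl

theorem unitaryGroup_row_dot {q : ℕ} (u : Matrix.unitaryGroup (Fin q) ℂ) (i j : Fin q) :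
    (u.1 *ᵥ fun r => star (u.1 j r)) i = if i = j then 1 else 0 := by
  rw [← mul_conjTranspose_apply]
  have := (Unitary.mem_iff.mp u.2).2
  rw [star_eq_conjTranspose] at this
  rw [this, one_apply]

theorem leftLayer_unitary (u : Fin m → Matrix.unitaryGroup (Fin 2) ℂ) :
    leftLayer u * (leftLayer u)ᴴ = 1 := by
  ext x y
  have hx := x.2
  rw [mul_conjTranspose_apply, leftLayer_mulVec, one_apply]
  by_cases hb : (x : ℕ) / 2 = (y : ℕ) / 2
  · have e1 : 2 * ((x : ℕ) / 2) % 2 = 0 := by omega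
    have e2 : (2 * ((x : ℕ) / 2) + 1) % 2 = 1 := by omega
    have e3 : (y : ℕ) / 2 = 2 * ((x : ℕ) / 2) / 2 := by omega
    have e4 : (y : ℕ) / 2 = (2 * ((x : ℕ) / 2) + 1) / 2 := by omega
    have h := unitaryGroup_row_dot (u ⟨(x : ℕ) / 2, by omega⟩) ⟨(x : ℕ) % 2, by omega⟩
      ⟨(y : ℕ) % 2, by omega⟩
    have hv : (![star (leftLayer u y ⟨2 * ((x : ℕ) / 2), by omega⟩),
        star (leftLayer u y ⟨2 * ((x : ℕ) / 2) + 1, by omega⟩)] : Fin 2 → ℂ) =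
        fun r => star ((u ⟨(x : ℕ) / 2, by omega⟩).1 ⟨(y : ℕ) % 2, by omega⟩ r) := by
      funext r
      fin_cases r
      · simp only [leftLayer, ← e3, if_true, e1, hb.symm]; rfl
      · simp only [leftLayer, ← e4, if_true, e2, hb.symm]; rfl
    rw [hv, h]
    congr 1
    rw [Fin.ext_iff, Fin.ext_iff]
    simp only [eq_iff_iff]
    omega
  · have hne : x ≠ y := by rintro rfl; exact hb rfl
    rw [if_neg hne]
    have e2 : (y : ℕ) / 2 ≠ (2 * ((x : ℕ) / 2) + 1) / 2 := by omega
    have e3 : (y : ℕ) / 2 ≠ (x : ℕ) / 2 := Ne.symm hb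
    simp [leftLayer, e2, e3, mulVec, dotProduct, Fin.sum_univ_two]

theorem unitaryGroup_one_mul_star (a : Matrix.unitaryGroup (Fin 1) ℂ) :
    a.1 0 0 * star (a.1 0 0) = 1 := by
  have h := unitaryGroup_row_dot a 0 0
  simpa [mulVec, dotProduct] using h

theorem rightLayer_unitary (u : Fin (m - 1) → Matrix.unitaryGroup (Fin 2) ℂ)
    (a b : Matrix.unitaryGroup (Fin 1) ℂ) :
    rightLayer u a b * (rightLayer u a b)ᴴ = 1 := by
  ext x y
  have hx2 := x.2
  have hy2 := y.2
  rw [mul_conjTranspose_apply, one_apply]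
  have hoff : ∀ z : Fin (2 * m), ((y : ℕ) + 1) / 2 ≠ ((z : ℕ) + 1) / 2 →
      rightLayer u a b y z = 0 := fun z hz => by simp [rightLayer, hz]
  by_cases hx : (x : ℕ) = 0
  · rw [rightLayer_mulVec_zero _ _ _ _ _ hx]
    by_cases hxy : x = y
    · subst hxy
      rw [if_pos rfl]
      simpa [rightLayer, hx] using unitaryGroup_one_mul_star a
    · rw [if_neg hxy, hoff x (by rw [Fin.ext_iff] at hxy; omega)]
      simp
  by_cases hx' : (x : ℕ) + 1 = 2 * m
  · rw [rightLayer_mulVec_last _ _ _ _ _ hx']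
    by_cases hxy : x = y
    · subst hxy
      rw [if_pos rfl]
      simpa [rightLayer, hx, hx'] using unitaryGroup_one_mul_star b
    · rw [if_neg hxy, hoff x (by rw [Fin.ext_iff] at hxy; omega)]
      simp
  rw [rightLayer_mulVec_inner _ _ _ _ _ hx hx']
  by_cases hb : ((x : ℕ) + 1) / 2 = ((y : ℕ) + 1) / 2
  · have hy : (y : ℕ) ≠ 0 := by omega
    have hy' : (y : ℕ) + 1 ≠ 2 * m := by omega
    have e1 : (2 * (((x : ℕ) - 1) / 2) + 1 + 1) % 2 = 0 := by omega
    have e2 : (2 * (((x : ℕ) - 1) / 2) + 2 + 1) % 2 = 1 := by omega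
    have e3 : ((y : ℕ) + 1) / 2 = (2 * (((x : ℕ) - 1) / 2) + 1 + 1) / 2 := by omega
    have e4 : ((y : ℕ) + 1) / 2 = (2 * (((x : ℕ) - 1) / 2) + 2 + 1) / 2 := by omega
    have e5 : ((y : ℕ) - 1) / 2 = ((x : ℕ) - 1) / 2 := by omega
    have h := unitaryGroup_row_dot (u ⟨((x : ℕ) - 1) / 2, by omega⟩) ⟨((x : ℕ) + 1) % 2, by omega⟩
      ⟨((y : ℕ) + 1) % 2, by omega⟩
    have hv : (![star (rightLayer u a b y ⟨2 * (((x : ℕ) - 1) / 2) + 1, by omega⟩),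
        star (rightLayer u a b y ⟨2 * (((x : ℕ) - 1) / 2) + 2, by omega⟩)] : Fin 2 → ℂ) =
        fun r => star ((u ⟨((x : ℕ) - 1) / 2, by omega⟩).1 ⟨((y : ℕ) + 1) % 2, by omega⟩ r) := by
      funext r
      fin_cases r
      · simp only [rightLayer, hy, hy', ← e3, if_true, dite_false, e1, e5]; rfl
      · simp only [rightLayer, hy, hy', ← e4, if_true, dite_false, e2, e5]; rfl
    rw [hv, h]
    congr 1
    rw [Fin.ext_iff, Fin.ext_iff]
    simp only [eq_iff_iff]
    omega
  · have hne : x ≠ y := by rintro rfl; exact hb rfl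
    rw [if_neg hne, hoff _ (by simp only; omega), hoff _ (by simp only; omega)]
    simp [mulVec, dotProduct, Fin.sum_univ_two]

theorem stepMatrix_unitary (g : StepGates m) : stepMatrix g * (stepMatrix g)ᴴ = 1 :=
  unitary_mul (rightLayer_unitary _ _ _) (leftLayer_unitary _)

theorem brickwall_zero (g : CircuitGates m 0) : brickwall g = 1 := by simp [brickwall]

theorem brickwall_succ {d : ℕ} (g : CircuitGates m (d + 1)) :
    brickwall g = brickwall (fun i => g i.succ) * stepMatrix (g 0) := by
  simp [brickwall, List.ofFn_succ]

theorem brickwall_unitary {d : ℕ} (g : CircuitGates m d) :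
    brickwall g * (brickwall g)ᴴ = 1 := by
  induction d with
  | zero => rw [brickwall_zero]; simp
  | succ d ih => rw [brickwall_succ]; exact unitary_mul (ih _) (stepMatrix_unitary _)

/-! ### Rank of the parity commutator across the cut -/

theorem rank_le_card_of_rows_eq_zero {ι : Type} [Fintype ι] [DecidableEq ι] (S : Finset ι)
    {M : Matrix ι ι ℂ} (h : ∀ x ∉ S, ∀ y, M x y = 0) : M.rank ≤ S.card := by
  have hM : M = diagonal (fun x => if x ∈ S then (1 : ℂ) else 0) * M := by
    ext x y
    rw [diagonal_mul]
    by_cases hx : x ∈ S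
    · simp [hx]
    · simp [hx, h x hx y]
  rw [hM]
  refine (rank_mul_le_left _ _).trans ?_
  rw [rank_diagonal, Fintype.card_subtype]
  refine Finset.card_le_card fun x hx => ?_
  by_contra hxS
  simp [hxS] at hx

theorem parityComm_apply {ι : Type} [Fintype ι] [DecidableEq ι] (Γ : Finset ι) (M : Matrix ι ι ℂ)
    (x y : ι) : parityComm Γ M x y =
      M x y * ((if y ∈ Γ then -1 else 1) - if x ∈ Γ then -1 else 1) := by
  simp only [parityComm, parity, Matrix.sub_apply, mul_diagonal, diagonal_mul]
  ring

theorem card_filter_cut_le (n k : ℕ) :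
    (Finset.univ.filter fun x : Fin n => (x : ℕ) + 1 = k ∨ (x : ℕ) = k).card ≤ 2 := by
  refine le_trans (Finset.card_le_card_of_injOn (fun x : Fin n => (x : ℕ))
    (t := ({k - 1, k} : Finset ℕ)) ?_ ?_) (Finset.card_le_two)
  · intro x hx
    simp only [Finset.coe_filter, Finset.mem_univ, true_and, Set.mem_ofPred_eq] at hx
    simp only [Finset.coe_insert, Finset.coe_singleton, Set.mem_insert_iff, Set.mem_singleton_iff]
    omega
  · exact fun x _ y _ h => Fin.ext h

/-- A block-diagonal layer with blocks of adjacent modes contributes only across the cut. -/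
theorem rank_parityComm_layer_le (k : ℕ) {M : Matrix (Fin (2 * m)) (Fin (2 * m)) ℂ} (c : ℕ)
    (hM : ∀ x y : Fin (2 * m), ((x : ℕ) + c) / 2 ≠ ((y : ℕ) + c) / 2 → M x y = 0) :
    (parityComm (firstModes m k) M).rank ≤ if (k + c) % 2 = 0 then 0 else 2 := by
  split_ifs with hk
  · have : parityComm (firstModes m k) M = 0 := by
      ext x y
      rw [parityComm_apply]
      by_cases hxy : ((x : ℕ) + c) / 2 = ((y : ℕ) + c) / 2
      · have : x ∈ firstModes m k ↔ y ∈ firstModes m k := by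
          simp only [firstModes, Finset.mem_filter, Finset.mem_univ, true_and]
          omega
        simp [this]
      · simp [hM x y hxy]
    rw [this, rank_zero]
  · refine (rank_le_card_of_rows_eq_zero _ fun x hx y => ?_).trans (card_filter_cut_le (2 * m) k)
    rw [parityComm_apply]
    by_cases hxy : ((x : ℕ) + c) / 2 = ((y : ℕ) + c) / 2
    · have : x ∈ firstModes m k ↔ y ∈ firstModes m k := by
        simp only [firstModes, Finset.mem_filter, Finset.mem_univ, true_and] at hx ⊢
        omega
      simp [this]
    · simp [hM x y hxy]

/-- Exactly one of k and k + 1 is even, so only one of the two layers of a step can split a gate at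
the cut. -/
theorem rank_parityComm_stepMatrix_le (k : ℕ) (g : StepGates m) :
    (parityComm (firstModes m k) (stepMatrix g)).rank ≤ 2 := by
  refine (rank_parityComm_mul_le _ _ _).trans ?_
  have h1 := rank_parityComm_layer_le k (M := leftLayer g.1) 0
    (fun x y h => if_neg (by simpa using h))
  have h2 := rank_parityComm_layer_le k (M := rightLayer g.2.1 g.2.2.1 g.2.2.2) 1
    (fun x y h => if_neg h)
  split_ifs at h1 h2 <;> omega

theorem rank_parityComm_brickwall_le {d : ℕ} (k : ℕ) (g : CircuitGates m d) :
    (parityComm (firstModes m k) (brickwall g)).rank ≤ 2 * d := by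
  induction d with
  | zero => rw [brickwall_zero, parityComm_one, rank_zero]
  | succ d ih =>
    rw [brickwall_succ]
    have h1 := rank_parityComm_mul_le (firstModes m k) (brickwall fun i => g i.succ)
      (stepMatrix (g 0))
    have h2 := ih fun i => g i.succ
    have h3 := rank_parityComm_stepMatrix_le k (g 0)
    omega

theorem entropy_le_depth {d : ℕ} (k : ℕ) {s : ℝ} (hs : 0 < s) (g : CircuitGates m d) :
    entropy s k g ≤ 4 * (d : ℝ) * Real.log (Real.cosh (2 * s)) := by
  refine (renyi2_le_rank hs _ (brickwall_unitary g)).trans ?_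
  have h1 := rank_parityComm_mul_le (firstModes m k) (brickwall g) (brickwall g)ᵀ
  rw [rank_parityComm_transpose] at h1
  have h2 := rank_parityComm_brickwall_le k g
  have h3 : (parityComm (firstModes m k) (brickwall g * (brickwall g)ᵀ)).rank ≤ 4 * d := by omega
  have h4 : ((parityComm (firstModes m k) (brickwall g * (brickwall g)ᵀ)).rank : ℝ) ≤ 4 * d := by
    exact_mod_cast h3
  have hlog : 0 ≤ Real.log (Real.cosh (2 * s)) := Real.log_nonneg (Real.one_le_cosh _)
  have hd : (0 : ℝ) ≤ 4 * d := by positivity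
  nlinarith [mul_le_mul_of_nonneg_right h4 hlog, mul_nonneg hd hlog]

theorem entropy_nonneg {d : ℕ} (k : ℕ) {s : ℝ} (hs : 0 < s) (g : CircuitGates m d) :
    0 ≤ entropy s k g := renyi2_nonneg hs _ (brickwall_unitary g)

end

section

/-! ### Haar-random gates -/

instance isProbabilityMeasure_haarUnitary (q : ℕ) : IsProbabilityMeasure (haarUnitary q) :=
  ⟨Measure.haarMeasure_self⟩

instance isMulLeftInvariant_haarUnitary (q : ℕ) : (haarUnitary q).IsMulLeftInvariant := by
  unfold haarUnitary; infer_instance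

theorem measurable_unitaryGroup_apply {q : ℕ} (i j : Fin q) :
    Measurable fun u : Matrix.unitaryGroup (Fin q) ℂ => u.1 i j := by
  have : Continuous fun u : Matrix.unitaryGroup (Fin q) ℂ => u.1 i j := 
    continuous_subtype_val.matrix_elem i j
  exact this.measurable
theorem measurable_mulVec_apply {α ι : Type} [Fintype ι] [MeasurableSpace α] {M : α → Matrix ι ι ℂ}
    {v : α → ι → ℂ} (hM : ∀ x y, Measurable fun a => M a x y) (hv : ∀ x, Measurable fun a => v a x)
    (x : ι) : Measurable fun a => (M a *ᵥ v a) x := by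
  unfold mulVec dotProduct
  exact Finset.measurable_sum _ fun y _ => (hM x y).mul (hv y)
theorem measurable_ofReal_norm_sq {α : Type} [MeasurableSpace α] {f : α → ℂ} (hf : Measurable f) :
   Measurable fun a => ENNReal.ofReal (‖f a‖ ^ 2) := 
    ENNReal.measurable_ofReal.comp (hf.norm.pow_const 2)

/-- Under a Haar-random two-mode gate the intensity is equidistributed over the two modes. -/
theorem lintegral_haarUnitary_two (v : Fin 2 → ℂ) (i : Fin 2) :
    ∫⁻ u, ENNReal.ofReal (‖(u.1 *ᵥ v) i‖ ^ 2) ∂(haarUnitary 2) =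
      ENNReal.ofReal ((‖v 0‖ ^ 2 + ‖v 1‖ ^ 2) / 2) := by
  have hmeas : ∀ i : Fin 2, Measurable fun u : Matrix.unitaryGroup (Fin 2) ℂ =>
      ENNReal.ofReal (‖(u.1 *ᵥ v) i‖ ^ 2) := fun i =>
    measurable_ofReal_norm_sq (measurable_mulVec_apply
      (M := fun u : Matrix.unitaryGroup (Fin 2) ℂ => u.1) (v := fun _ => v)
      measurable_unitaryGroup_apply (fun _ => measurable_const) i)
  have hmem : (!![0, 1; 1, 0] : Matrix (Fin 2) (Fin 2) ℂ) ∈ Matrix.unitaryGroup (Fin 2) ℂ := by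
    rw [Matrix.mem_unitaryGroup_iff]
    ext a b
    fin_cases a <;> fin_cases b <;> simp [Matrix.mul_apply, star_eq_conjTranspose, Fin.sum_univ_two]
  -- Left invariance under the swap matrix equates the two mean intensities; unitarity fixes their
  -- sum.
  have hswap : ∫⁻ u, ENNReal.ofReal (‖(u.1 *ᵥ v) 0‖ ^ 2) ∂(haarUnitary 2) =
      ∫⁻ u, ENNReal.ofReal (‖(u.1 *ᵥ v) 1‖ ^ 2) ∂(haarUnitary 2) := by
    rw [← lintegral_mul_left_eq_self (μ := haarUnitary 2) _
      (⟨!![0, 1; 1, 0], hmem⟩ : Matrix.unitaryGroup (Fin 2) ℂ)]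
    congr 1
    ext u
    congr 3
    change ((!![0, 1; 1, 0] * u.1) *ᵥ v) 0 = _
    rw [← mulVec_mulVec]
    simp [mulVec, dotProduct, Fin.sum_univ_two]
  have hsum : ∫⁻ u, ENNReal.ofReal (‖(u.1 *ᵥ v) 0‖ ^ 2) ∂(haarUnitary 2) +
      ∫⁻ u, ENNReal.ofReal (‖(u.1 *ᵥ v) 1‖ ^ 2) ∂(haarUnitary 2) =
      ENNReal.ofReal (‖v 0‖ ^ 2 + ‖v 1‖ ^ 2) := by
    rw [← lintegral_add_left (hmeas 0)]
    have : ∀ u : Matrix.unitaryGroup (Fin 2) ℂ, ENNReal.ofReal (‖(u.1 *ᵥ v) 0‖ ^ 2) +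
        ENNReal.ofReal (‖(u.1 *ᵥ v) 1‖ ^ 2) = ENNReal.ofReal (‖v 0‖ ^ 2 + ‖v 1‖ ^ 2) := by
      intro u
      rw [← ENNReal.ofReal_add (by positivity) (by positivity)]
      have := sum_norm_sq_mulVec (P := u.1) ((Unitary.mem_iff.mp u.2).1) v
      rw [Fin.sum_univ_two, Fin.sum_univ_two] at this
      rw [this]
    simp_rw [this]
    simp
  have h0 : ∫⁻ u, ENNReal.ofReal (‖(u.1 *ᵥ v) 0‖ ^ 2) ∂(haarUnitary 2) =
      ENNReal.ofReal ((‖v 0‖ ^ 2 + ‖v 1‖ ^ 2) / 2) := by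
    rw [← hswap, ← two_mul] at hsum
    rw [ENNReal.ofReal_div_of_pos (by norm_num), ← hsum]
    simp only [ENNReal.ofReal_ofNat]
    rw [mul_comm, ENNReal.mul_div_cancel_right (by norm_num) (by norm_num)]
  fin_cases i
  · exact h0
  · exact hswap.symm.trans h0

/-- The intensity of `v` weighted by `w`. -/
def energy {n : ℕ} (w : Fin n → ℝ) (v : Fin n → ℂ) : ENNReal :=
  ∑ x, ENNReal.ofReal (w x) * ENNReal.ofReal (‖v x‖ ^ 2)

theorem energy_eq_ofReal {n : ℕ} {w : Fin n → ℝ} (hw : ∀ x, 0 ≤ w x) (v : Fin n → ℂ) :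
    energy w v = ENNReal.ofReal (∑ x, w x * ‖v x‖ ^ 2) := by
  rw [energy, ENNReal.ofReal_sum_of_nonneg fun x _ => mul_nonneg (hw x) (sq_nonneg _)]
  exact Finset.sum_congr rfl fun x _ => (ENNReal.ofReal_mul (hw x)).symm

theorem measurable_energy {α : Type} [MeasurableSpace α] {n : ℕ} (w : Fin n → ℝ)
    {v : α → Fin n → ℂ} (hv : ∀ x, Measurable fun a => v a x) :
    Measurable fun a => energy w (v a) :=
  Finset.measurable_sum _ fun x _ =>
    (measurable_ofReal_norm_sq (hv x)).const_mul _

/-- A random layer that averages intensities over the orbits of an involution `p` contracts weighted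
intensities as soon as the weights do. -/
theorem lintegral_energy_le {α : Type} [MeasurableSpace α] (μ : Measure α) {n : ℕ}
    {w w' : Fin n → ℝ} {c : ℝ} (hw : ∀ x, 0 ≤ w x) (hw' : ∀ x, 0 ≤ w' x) (hc : 0 ≤ c)
    {p : Fin n → Fin n} (hp : Function.Involutive p) (hwp : ∀ x, (w x + w (p x)) / 2 ≤ c * w' x)
    {v : Fin n → ℂ} {f : α → Fin n → ℂ} (hf : ∀ x, Measurable fun a => f a x)
    (hE : ∀ x, ∫⁻ a, ENNReal.ofReal (‖f a x‖ ^ 2) ∂μ =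
      ENNReal.ofReal ((‖v x‖ ^ 2 + ‖v (p x)‖ ^ 2) / 2)) :
    ∫⁻ a, energy w (f a) ∂μ ≤ ENNReal.ofReal c * energy w' v := by
  have hm : ∀ x, Measurable fun a => ENNReal.ofReal (‖f a x‖ ^ 2) := fun x =>
    measurable_ofReal_norm_sq (hf x)
  have h1 : ∫⁻ a, energy w (f a) ∂μ =
      ENNReal.ofReal (∑ x, w x * ((‖v x‖ ^ 2 + ‖v (p x)‖ ^ 2) / 2)) := by
    unfold energy
    rw [lintegral_finsetSum _ fun x _ => (hm x).const_mul _,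
      ENNReal.ofReal_sum_of_nonneg fun x _ => mul_nonneg (hw x) (by positivity)]
    refine Finset.sum_congr rfl fun x _ => ?_
    rw [lintegral_const_mul _ (hm x), hE, ENNReal.ofReal_mul (hw x)]
  rw [h1, energy_eq_ofReal hw', ← ENNReal.ofReal_mul hc]
  refine ENNReal.ofReal_le_ofReal ?_
  have h2 : ∑ x, w x * ‖v (p x)‖ ^ 2 = ∑ x, w (p x) * ‖v x‖ ^ 2 := by
    refine Fintype.sum_equiv hp.toPerm _ _ fun x => ?_
    simp [hp x]
  calc ∑ x, w x * ((‖v x‖ ^ 2 + ‖v (p x)‖ ^ 2) / 2)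
      = (∑ x, w x * ‖v x‖ ^ 2 + ∑ x, w x * ‖v (p x)‖ ^ 2) / 2 := by
        rw [← Finset.sum_add_distrib, Finset.sum_div]
        exact Finset.sum_congr rfl fun x _ => by ring
    _ = ∑ x, (w x + w (p x)) / 2 * ‖v x‖ ^ 2 := by
        rw [h2, ← Finset.sum_add_distrib, Finset.sum_div]
        exact Finset.sum_congr rfl fun x _ => by ring
    _ ≤ c * ∑ x, w' x * ‖v x‖ ^ 2 := by
        rw [Finset.mul_sum]
        refine Finset.sum_le_sum fun x _ => ?_
        rw [← mul_assoc]
        exact mul_le_mul_of_nonneg_right (hwp x) (sq_nonneg _)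

end

section

/-! ### Diffusion of the intensity in a random circuit -/

variable {m : ℕ}

/-! ### Measurability of circuit entries in the gates -/

theorem measurable_leftLayer_apply (x y : Fin (2 * m)) :
    Measurable fun u : Fin m → Matrix.unitaryGroup (Fin 2) ℂ => leftLayer u x y := by
  unfold leftLayer
  split_ifs
  · exact (measurable_unitaryGroup_apply _ _).comp (measurable_pi_apply _)
  · exact measurable_const

theorem measurable_rightLayer_apply (x y : Fin (2 * m)) :
    Measurable fun g : (Fin (m - 1) → Matrix.unitaryGroup (Fin 2) ℂ) ×
      Matrix.unitaryGroup (Fin 1) ℂ × Matrix.unitaryGroup (Fin 1) ℂ =>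
      rightLayer g.1 g.2.1 g.2.2 x y := by
  unfold rightLayer
  split_ifs
  · exact (measurable_unitaryGroup_apply _ _).comp (measurable_fst.comp measurable_snd)
  · exact (measurable_unitaryGroup_apply _ _).comp (measurable_snd.comp measurable_snd)
  · exact (measurable_unitaryGroup_apply _ _).comp ((measurable_pi_apply _).comp measurable_fst)
  · exact measurable_const

theorem measurable_mul_apply {α ι : Type} [Fintype ι] [MeasurableSpace α] {M N : α → Matrix ι ι ℂ}
    (hM : ∀ x y, Measurable fun a => M a x y) (hN : ∀ x y, Measurable fun a => N a x y)
    (x y : ι) : Measurable fun a => (M a * N a) x y := by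
  simp only [Matrix.mul_apply]
  exact Finset.measurable_sum _ fun z _ => (hM x z).mul (hN z y)

theorem measurable_stepMatrix_apply (x y : Fin (2 * m)) :
    Measurable fun g : StepGates m => stepMatrix g x y :=
  measurable_mul_apply (M := fun g : StepGates m => rightLayer g.2.1 g.2.2.1 g.2.2.2)
    (N := fun g : StepGates m => leftLayer g.1)
    (fun x y => (measurable_rightLayer_apply x y).comp measurable_snd)
    (fun x y => (measurable_leftLayer_apply x y).comp measurable_fst) x y

theorem measurable_brickwall_apply {d : ℕ} (x y : Fin (2 * m)) :
    Measurable fun g : CircuitGates m d => brickwall g x y := by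
  induction d generalizing x y with
  | zero => simp_rw [brickwall_zero]; exact measurable_const
  | succ d ih =>
    simp_rw [brickwall_succ]
    refine measurable_mul_apply (M := fun g : CircuitGates m (d + 1) => brickwall fun i => g i.succ)
      (N := fun g : CircuitGates m (d + 1) => stepMatrix (g 0)) (fun x y => ?_) (fun x y => ?_) x y
    · exact (ih x y).comp (measurable_pi_lambda _ fun i => measurable_pi_apply _)
    · exact (measurable_stepMatrix_apply x y).comp (measurable_pi_apply _)

/-- The other mode of the two-mode gate of the layer `U^L` acting on a mode. -/
def leftPartner (x : Fin (2 * m)) : Fin (2 * m) :=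
  if h : (x : ℕ) % 2 = 0 then ⟨x + 1, by omega⟩ else ⟨x - 1, by omega⟩

/-- The other mode of the gate of the layer `U^R` acting on a mode. -/
def rightPartner (x : Fin (2 * m)) : Fin (2 * m) :=
  if h : (x : ℕ) = 0 ∨ (x : ℕ) + 1 = 2 * m then x
  else if h' : (x : ℕ) % 2 = 1 then ⟨x + 1, by omega⟩ else ⟨x - 1, by omega⟩

theorem leftPartner_involutive : Function.Involutive (leftPartner (m := m)) := by
  intro x
  unfold leftPartner
  rw [Fin.ext_iff]
  split_ifs with h1 h2 h2 <;> simp at h1 h2 ⊢ <;> omega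

theorem rightPartner_involutive : Function.Involutive (rightPartner (m := m)) := by
  intro x
  have hx := x.2
  by_cases h : (x : ℕ) = 0 ∨ (x : ℕ) + 1 = 2 * m
  · have e : rightPartner x = x := dif_pos h
    rw [e, e]
  by_cases h' : (x : ℕ) % 2 = 1
  · have e : rightPartner x = ⟨x + 1, by omega⟩ := by rw [rightPartner, dif_neg h, dif_pos h']
    rw [e, rightPartner, dif_neg (by simp only; omega), dif_neg (by simp only; omega)]
    rfl
  · have e : rightPartner x = ⟨x - 1, by omega⟩ := by rw [rightPartner, dif_neg h, dif_neg h']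
    rw [e, rightPartner, dif_neg (by simp only; omega), dif_pos (by simp only; omega), Fin.ext_iff]
    simp only
    omega

theorem lintegral_leftLayer (v : Fin (2 * m) → ℂ) (x : Fin (2 * m)) :
    ∫⁻ u, ENNReal.ofReal (‖(leftLayer u *ᵥ v) x‖ ^ 2) ∂(Measure.pi fun _ : Fin m => haarUnitary 2) =
      ENNReal.ofReal ((‖v x‖ ^ 2 + ‖v (leftPartner x)‖ ^ 2) / 2) := by
  simp_rw [leftLayer_mulVec]
  have hx := x.2
  have hmp := measurePreserving_eval (fun _ : Fin m => haarUnitary 2) ⟨(x : ℕ) / 2, by omega⟩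
  have h := hmp.lintegral_comp (measurable_ofReal_norm_sq (measurable_mulVec_apply
      (M := fun u : Matrix.unitaryGroup (Fin 2) ℂ => u.1)
      (v := fun _ => ![v ⟨2 * ((x : ℕ) / 2), by omega⟩, v ⟨2 * ((x : ℕ) / 2) + 1, by omega⟩])
      measurable_unitaryGroup_apply (fun _ => measurable_const) ⟨(x : ℕ) % 2, by omega⟩))
  refine h.trans ?_
  rw [lintegral_haarUnitary_two]
  congr 2
  simp only [cons_val_zero, cons_val_one]
  unfold leftPartner
  split_ifs with h0
  · congr 4 <;> rw [Fin.ext_iff] <;> simp only <;> omega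
  · rw [add_comm]
    congr 4 <;> rw [Fin.ext_iff] <;> simp only <;> omega

theorem norm_unitaryGroup_one (a : Matrix.unitaryGroup (Fin 1) ℂ) : ‖a.1 0 0‖ = 1 := by
  have h := unitaryGroup_one_mul_star a
  rw [Complex.star_def, Complex.mul_conj, Complex.normSq_eq_norm_sq] at h
  have h5 : ‖a.1 0 0‖ ^ 2 = 1 := by exact_mod_cast h
  nlinarith [norm_nonneg (a.1 0 0)]

theorem lintegral_rightLayer (v : Fin (2 * m) → ℂ) (x : Fin (2 * m)) :
    ∫⁻ g, ENNReal.ofReal (‖(rightLayer g.1 g.2.1 g.2.2 *ᵥ v) x‖ ^ 2)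
        ∂((Measure.pi fun _ : Fin (m - 1) => haarUnitary 2).prod
          ((haarUnitary 1).prod (haarUnitary 1))) =
      ENNReal.ofReal ((‖v x‖ ^ 2 + ‖v (rightPartner x)‖ ^ 2) / 2) := by
  have hx := x.2
  by_cases h0 : (x : ℕ) = 0
  · simp_rw [rightLayer_mulVec_zero _ _ _ v x h0, norm_mul, norm_unitaryGroup_one]
    rw [lintegral_const, measure_univ]
    simp [rightPartner, h0]
  by_cases h1 : (x : ℕ) + 1 = 2 * m
  · simp_rw [rightLayer_mulVec_last _ _ _ v x h1, norm_mul, norm_unitaryGroup_one]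
    rw [lintegral_const, measure_univ]
    simp [rightPartner, h1]
  simp_rw [rightLayer_mulVec_inner _ _ _ v x h0 h1]
  have hmp := (measurePreserving_eval (fun _ : Fin (m - 1) => haarUnitary 2)
    ⟨((x : ℕ) - 1) / 2, by omega⟩).comp (measurePreserving_fst
      (μ := Measure.pi fun _ : Fin (m - 1) => haarUnitary 2)
      (ν := (haarUnitary 1).prod (haarUnitary 1)))
  have h := hmp.lintegral_comp (measurable_ofReal_norm_sq (measurable_mulVec_apply
      (M := fun u : Matrix.unitaryGroup (Fin 2) ℂ => u.1)
      (v := fun _ => ![v ⟨2 * (((x : ℕ) - 1) / 2) + 1, by omega⟩,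
        v ⟨2 * (((x : ℕ) - 1) / 2) + 2, by omega⟩])
      measurable_unitaryGroup_apply (fun _ => measurable_const) ⟨((x : ℕ) + 1) % 2, by omega⟩))
  refine h.trans ?_
  rw [lintegral_haarUnitary_two]
  congr 2
  simp only [cons_val_zero, cons_val_one]
  unfold rightPartner
  rw [dif_neg (by omega)]
  split_ifs with h2
  · congr 4 <;> rw [Fin.ext_iff] <;> simp only <;> omega
  · rw [add_comm]
    congr 4 <;> rw [Fin.ext_iff] <;> simp only <;> omega

/-- The weight centred at `y` that is constant on the blocks of the layer `U^L`. -/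
def leftWeight (l : ℝ) (y x : Fin (2 * m)) : ℝ :=
  Real.cosh (l * (2 * (((x : ℕ) / 2 : ℕ) : ℝ) + 1 / 2 - ((y : ℕ) : ℝ)))

/-- The weight centred at `y` that is constant on the blocks of the layer `U^R`. -/
def rightWeight (l : ℝ) (y x : Fin (2 * m)) : ℝ :=
  Real.cosh (l * (2 * ((((x : ℕ) + 1) / 2 : ℕ) : ℝ) - 1 / 2 - ((y : ℕ) : ℝ)))

theorem cosh_average (a b : ℝ) :
    (Real.cosh (a - b) + Real.cosh (a + b)) / 2 = Real.cosh b * Real.cosh a := by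
  rw [Real.cosh_sub, Real.cosh_add]; ring

/-- The two modes of a U^L block lie in U^R blocks centred one unit to the left and right of its own
centre. The addition formula for cosh thus gives exactly the factor cosh l, including at the ends,
where the one-mode blocks get centres half a site outside the chain. -/
theorem rightWeight_average (l : ℝ) (y x : Fin (2 * m)) :
    (rightWeight l y x + rightWeight l y (leftPartner x)) / 2 ≤ Real.cosh l * leftWeight l y x := by
  refine le_of_eq ?_
  unfold rightWeight leftWeight leftPartner
  obtain ⟨j, hj | hj⟩ : ∃ j, (x : ℕ) = 2 * j ∨ (x : ℕ) = 2 * j + 1 := ⟨(x : ℕ) / 2, by omega⟩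
  · have e1 : (x : ℕ) % 2 = 0 := by omega
    have e2 : (x : ℕ) / 2 = j := by omega
    have e3 : ((x : ℕ) + 1) / 2 = j := by omega
    have e4 : ((x : ℕ) + 1 + 1) / 2 = j + 1 := by omega
    simp only [e1, dite_true, e2, e3, e4]
    rw [← cosh_average]
    push_cast
    congr 3 <;> ring
  · have e1 : ¬ (x : ℕ) % 2 = 0 := by omega
    have e2 : (x : ℕ) / 2 = j := by omega
    have e3 : ((x : ℕ) + 1) / 2 = j + 1 := by omega
    have e4 : ((x : ℕ) - 1 + 1) / 2 = j := by omega
    simp only [e1, dite_false, e2, e3, e4]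
    rw [← cosh_average, add_comm]
    push_cast
    congr 3 <;> ring

theorem leftWeight_average (l : ℝ) (y x : Fin (2 * m)) :
    (leftWeight l y x + leftWeight l y (rightPartner x)) / 2 ≤ Real.cosh l * rightWeight l y x := by
  have hy : ((y : ℕ) : ℝ) + 1 ≤ 2 * m := by exact_mod_cast y.2
  have hy0 : (0 : ℝ) ≤ ((y : ℕ) : ℝ) := Nat.cast_nonneg _
  by_cases h : (x : ℕ) = 0 ∨ (x : ℕ) + 1 = 2 * m
  · have e : rightPartner x = x := by rw [rightPartner, dif_pos h]
    rw [e, add_self_div_two]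
    -- At an end mode nothing is averaged. The virtual centre -1/2 or 2m - 1/2 of its U^R block is
    -- at least as far from y as the centre of its U^L block, so the reflecting boundary does not
    -- increase the weight.
    have h1 : leftWeight l y x ≤ rightWeight l y x := by
      unfold leftWeight rightWeight
      rw [Real.cosh_le_cosh, abs_mul, abs_mul]
      refine mul_le_mul_of_nonneg_left ?_ (abs_nonneg _)
      rcases h with h | h
      · rw [h]
        norm_num
        rw [← sq_le_sq]
        nlinarith
      · have e1 : 2 * (((x : ℕ) / 2 : ℕ) : ℝ) = 2 * m - 2 := by
          have : 2 * ((x : ℕ) / 2) + 2 = 2 * m := by omega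
          have : (2 * (((x : ℕ) / 2 : ℕ) : ℝ)) + 2 = 2 * m := by exact_mod_cast this
          linarith
        have e2 : 2 * ((((x : ℕ) + 1) / 2 : ℕ) : ℝ) = 2 * m := by
          have : 2 * (((x : ℕ) + 1) / 2) = 2 * m := by omega
          exact_mod_cast this
        rw [e1, e2, ← sq_le_sq]
        nlinarith
    have h2 : 0 ≤ rightWeight l y x := (Real.cosh_pos _).le
    nlinarith [Real.one_le_cosh l]
  · refine le_of_eq ?_
    unfold rightWeight leftWeight rightPartner
    rw [dif_neg h]
    obtain ⟨j, hj | hj⟩ : ∃ j, (x : ℕ) = 2 * j + 1 ∨ (x : ℕ) = 2 * j + 2 :=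
      ⟨((x : ℕ) - 1) / 2, by omega⟩
    · have e1 : (x : ℕ) % 2 = 1 := by omega
      have e2 : (x : ℕ) / 2 = j := by omega
      have e3 : ((x : ℕ) + 1) / 2 = j + 1 := by omega
      simp only [e1, dite_true, e2, e3]
      rw [← cosh_average]
      push_cast
      congr 3 <;> ring
    · have e1 : ¬ (x : ℕ) % 2 = 1 := by omega
      have e2 : (x : ℕ) / 2 = j + 1 := by omega
      have e3 : ((x : ℕ) + 1) / 2 = j + 1 := by omega
      have e4 : ((x : ℕ) - 1) / 2 = j := by omega
      simp only [e1, dite_false, e2, e3, e4]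
      rw [← cosh_average, add_comm]
      push_cast
      congr 3 <;> ring

instance isProbabilityMeasure_haarStep (m : ℕ) : IsProbabilityMeasure (haarStep m) := by
  unfold haarStep; infer_instance

instance isProbabilityMeasure_haarCircuit (m d : ℕ) : IsProbabilityMeasure (haarCircuit m d) := by
  unfold haarCircuit; infer_instance

/-- Weights evolve backwards: averaging over U^R turns the left weight into the right one, then
averaging over U^L turns it back, each at the cost of a factor cosh l. -/
theorem lintegral_energy_stepMatrix_le (l : ℝ) (y : Fin (2 * m)) (v : Fin (2 * m) → ℂ) :
    ∫⁻ g, energy (leftWeight l y) (stepMatrix g *ᵥ v) ∂(haarStep m) ≤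
      ENNReal.ofReal (Real.cosh l ^ 2) * energy (leftWeight l y) v := by
  have hL : ∀ x, 0 ≤ leftWeight l y x := fun x => (Real.cosh_pos _).le
  have hR : ∀ x, 0 ≤ rightWeight l y x := fun x => (Real.cosh_pos _).le
  have hc : 0 ≤ Real.cosh l := (Real.cosh_pos l).le
  have hm : Measurable fun g : StepGates m => energy (leftWeight l y) (stepMatrix g *ᵥ v) :=
    measurable_energy _ (measurable_mulVec_apply (M := fun g : StepGates m => stepMatrix g)
      (v := fun _ => v) measurable_stepMatrix_apply fun _ => measurable_const)
  unfold haarStep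
  rw [lintegral_prod _ hm.aemeasurable]
  have h1 : ∀ u : Fin m → Matrix.unitaryGroup (Fin 2) ℂ,
      ∫⁻ g, energy (leftWeight l y) (stepMatrix (u, g) *ᵥ v)
        ∂((Measure.pi fun _ : Fin (m - 1) => haarUnitary 2).prod
          ((haarUnitary 1).prod (haarUnitary 1))) ≤
        ENNReal.ofReal (Real.cosh l) * energy (rightWeight l y) (leftLayer u *ᵥ v) := by
    intro u
    simp only [stepMatrix, ← mulVec_mulVec]
    exact lintegral_energy_le _ hL hR hc rightPartner_involutive (leftWeight_average l y)
      (measurable_mulVec_apply measurable_rightLayer_apply fun _ => measurable_const)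
      (lintegral_rightLayer _)
  refine (lintegral_mono h1).trans ?_
  have hv : ∀ x, Measurable fun u : Fin m → Matrix.unitaryGroup (Fin 2) ℂ =>
      (leftLayer u *ᵥ v) x :=
    measurable_mulVec_apply measurable_leftLayer_apply fun _ => measurable_const
  rw [lintegral_const_mul _ (measurable_energy _ hv), sq, ENNReal.ofReal_mul hc, mul_assoc]
  gcongr
  exact lintegral_energy_le _ hR hL hc leftPartner_involutive (rightWeight_average l y) hv
    (lintegral_leftLayer v)

theorem lintegral_energy_brickwall_le {d : ℕ} (l : ℝ) (y : Fin (2 * m)) (v : Fin (2 * m) → ℂ) :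
    ∫⁻ g, energy (leftWeight l y) (brickwall g *ᵥ v) ∂(haarCircuit m d) ≤
      ENNReal.ofReal (Real.cosh l ^ 2) ^ d * energy (leftWeight l y) v := by
  induction d generalizing v with
  | zero => simp [brickwall_zero]
  | succ d ih =>
    -- Independence separates the step that acts first; the induction hypothesis applies to the
    -- remaining steps with the output of that step as input.
    have hmp := measurePreserving_piFinSuccAbove (fun _ : Fin (d + 1) => haarStep m) 0
    have hm : Measurable fun p : StepGates m × CircuitGates m d =>
        energy (leftWeight l y) (brickwall p.2 *ᵥ (stepMatrix p.1 *ᵥ v)) :=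
      measurable_energy _ (measurable_mulVec_apply
        (M := fun p : StepGates m × CircuitGates m d => brickwall p.2)
        (v := fun p => stepMatrix p.1 *ᵥ v)
        (fun x y => (measurable_brickwall_apply x y).comp measurable_snd)
        (measurable_mulVec_apply (M := fun p : StepGates m × CircuitGates m d => stepMatrix p.1)
          (v := fun _ => v) (fun x y => (measurable_stepMatrix_apply x y).comp measurable_fst)
          fun _ => measurable_const))
    have h := hmp.lintegral_comp hm
    have e : ∀ g : CircuitGates m (d + 1), brickwall g *ᵥ v =
        brickwall (fun i => g i.succ) *ᵥ (stepMatrix (g 0) *ᵥ v) := fun g => by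
      rw [brickwall_succ, mulVec_mulVec]
    simp_rw [e]
    refine le_trans (le_of_eq h) ?_
    rw [lintegral_prod _ hm.aemeasurable]
    refine (lintegral_mono fun g => ih (stepMatrix g *ᵥ v)).trans ?_
    rw [lintegral_const_mul _ (measurable_energy _ (measurable_mulVec_apply
      (M := fun g : StepGates m => stepMatrix g)
      (v := fun _ => v) measurable_stepMatrix_apply fun _ => measurable_const)),
      pow_succ (ENNReal.ofReal _), mul_assoc]
    gcongr
    exact lintegral_energy_stepMatrix_le l y v

end

section

variable {m : ℕ}

/-! ### Measurability of the entropy -/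

theorem continuous_squeezedVacuum {ι : Type} [Fintype ι] (s : ℝ) :
    Continuous (squeezedVacuum s : (ι → ℂ) → ℂ) := by
  unfold squeezedVacuum
  fun_prop

theorem measurable_glue {α ι : Type} [DecidableEq ι] [MeasurableSpace α] (Γ : Finset ι)
    {z : α → {i // i ∈ Γ} → ℂ} {y : α → {i // i ∉ Γ} → ℂ} (hz : Measurable z) (hy : Measurable y)
    (i : ι) : Measurable fun a => glue Γ (z a) (y a) i := by
  unfold glue
  split_ifs with h
  · exact (measurable_pi_apply _).comp hz
  · exact (measurable_pi_apply _).comp hy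

theorem measurable_passiveUnitary {α ι : Type} [Fintype ι] [MeasurableSpace α] (s : ℝ)
    {M : α → Matrix ι ι ℂ} {z : α → ι → ℂ} (hM : ∀ x y, Measurable fun a => M a x y)
    (hz : ∀ x, Measurable fun a => z a x) :
    Measurable fun a => passiveUnitary (M a) (squeezedVacuum s) (z a) :=
  (continuous_squeezedVacuum s).measurable.comp (measurable_pi_lambda _ fun x =>
    measurable_mulVec_apply (M := fun a => (M a)ᵀ) (fun x y => hM y x) hz x)

theorem measurable_renyi2 {α ι : Type} [Fintype ι] [DecidableEq ι] [MeasurableSpace α] (s : ℝ)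
    (Γ : Finset ι) {M : α → Matrix ι ι ℂ} (hM : ∀ x y, Measurable fun a => M a x y) :
    Measurable fun a => renyi2 s Γ (M a) := by
  have h1 : StronglyMeasurable fun p : (α × ({i // i ∈ Γ} → ℂ)) × ({i // i ∈ Γ} → ℂ) =>
      reducedDensity Γ (passiveUnitary (M p.1.1) (squeezedVacuum s)) p.1.2 p.2 := by
    refine StronglyMeasurable.integral_prod_right' (f := fun q :
      ((α × ({i // i ∈ Γ} → ℂ)) × ({i // i ∈ Γ} → ℂ)) × ({i // i ∉ Γ} → ℂ) =>
        passiveUnitary (M q.1.1.1) (squeezedVacuum s) (glue Γ q.1.1.2 q.2) *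
        (starRingEnd ℂ) (passiveUnitary (M q.1.1.1) (squeezedVacuum s) (glue Γ q.1.2 q.2))) ?_
    refine Measurable.stronglyMeasurable (Measurable.mul ?_
      (Complex.continuous_conj.measurable.comp ?_)) <;>
    refine measurable_passiveUnitary s (fun x y => (hM x y).comp (by fun_prop))
      (measurable_glue Γ (by fun_prop) (by fun_prop))
  have h2 : StronglyMeasurable fun p : (α × ({i // i ∈ Γ} → ℂ)) × ({i // i ∈ Γ} → ℂ) =>
      reducedDensity Γ (passiveUnitary (M p.1.1) (squeezedVacuum s)) p.2 p.1.2 :=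
    h1.comp_measurable (g := fun p : (α × ({i // i ∈ Γ} → ℂ)) × ({i // i ∈ Γ} → ℂ) =>
      ((p.1.1, p.2), p.1.2)) (by fun_prop)
  have h3 : StronglyMeasurable fun a => traceSq (reducedDensity Γ
      (passiveUnitary (M a) (squeezedVacuum s))) :=
    (h1.mul h2).integral_prod_right'.integral_prod_right'
  exact (Real.measurable_log.comp (Complex.measurable_re.comp h3.measurable)).neg

theorem measurable_entropy (m d k : ℕ) (s : ℝ) :
    Measurable fun g : CircuitGates m d => entropy s k g :=
  measurable_renyi2 s _ measurable_brickwall_apply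

/-! ### Light cone -/

/-- Bandwidths add under multiplication; each layer has bandwidth 1, so depth d gives a light cone
of radius 2d. -/
theorem mul_apply_eq_zero_of_banded {n a b : ℕ} {M N : Matrix (Fin n) (Fin n) ℂ}
    (hM : ∀ x y : Fin n, (x : ℕ) + a < y ∨ (y : ℕ) + a < x → M x y = 0)
    (hN : ∀ x y : Fin n, (x : ℕ) + b < y ∨ (y : ℕ) + b < x → N x y = 0) (x y : Fin n)
    (h : (x : ℕ) + (a + b) < y ∨ (y : ℕ) + (a + b) < x) : (M * N) x y = 0 := by
  rw [Matrix.mul_apply]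
  refine Finset.sum_eq_zero fun z _ => ?_
  by_cases h1 : (x : ℕ) + a < z ∨ (z : ℕ) + a < x
  · rw [hM x z h1, zero_mul]
  · rw [hN z y (by omega), mul_zero]

theorem stepMatrix_apply_eq_zero (g : StepGates m) (x y : Fin (2 * m))
    (h : (x : ℕ) + 2 < y ∨ (y : ℕ) + 2 < x) : stepMatrix g x y = 0 := by
  refine mul_apply_eq_zero_of_banded (a := 1) (b := 1) (fun x y h => ?_) (fun x y h => ?_) x y h
  · exact if_neg (by omega)
  · exact if_neg (by omega)

theorem brickwall_apply_eq_zero {d : ℕ} (g : CircuitGates m d) (x y : Fin (2 * m))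
    (h : (x : ℕ) + 2 * d < y ∨ (y : ℕ) + 2 * d < x) : brickwall g x y = 0 := by
  induction d generalizing x y with
  | zero =>
    rw [brickwall_zero, one_apply_ne]
    rintro rfl
    omega
  | succ d ih =>
    rw [brickwall_succ]
    exact mul_apply_eq_zero_of_banded (ih _) (stepMatrix_apply_eq_zero _) x y (by omega)

/-! ### Transport across the cut -/

/-- The intensity transported from `y` across the cut at `k` over a distance of at least `N`. -/
def farColumn (k N : ℕ) (U : Matrix (Fin (2 * m)) (Fin (2 * m)) ℂ) (y : Fin (2 * m)) : ℝ :=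
  ∑ x : Fin (2 * m), if ((x : ℕ) < k ↔ (y : ℕ) < k) ∨ ((x : ℕ) < y + N ∧ (y : ℕ) < x + N) then 0
    else ‖U x y‖ ^ 2

theorem farColumn_nonneg (k N : ℕ) (U : Matrix (Fin (2 * m)) (Fin (2 * m)) ℂ) (y : Fin (2 * m)) :
    0 ≤ farColumn k N U y := by
  refine Finset.sum_nonneg fun x _ => ?_
  split_ifs <;> positivity

/-- The intensity transported across the cut at `k` over a distance of at least `N`. -/
def farTransport (k N : ℕ) (U : Matrix (Fin (2 * m)) (Fin (2 * m)) ℂ) : ℝ :=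
  ∑ y, farColumn k N U y

theorem sum_norm_sq_row {n : ℕ} {U : Matrix (Fin n) (Fin n) ℂ} (hU : U * Uᴴ = 1) (x : Fin n) :
    ∑ y, ‖U x y‖ ^ 2 = 1 := by
  have h := congrFun (congrFun hU x) x
  rw [mul_conjTranspose_apply, one_apply_eq] at h
  have h2 : ((∑ y, ‖U x y‖ ^ 2 : ℝ) : ℂ) = 1 := by
    rw [ofReal_sum_norm_sq, ← h, dotProduct_comm]; rfl
  exact_mod_cast h2

theorem card_filter_near_le (n k N : ℕ) :
    (Finset.univ.filter fun x : Fin n => (x : ℕ) < k + N ∧ k < x + N).card ≤ 2 * N := by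
  refine le_trans (Finset.card_le_card_of_injOn (fun x : Fin n => (x : ℕ))
    (t := Finset.Ico (k - N) (k + N)) ?_ ?_) ?_
  · intro x hx
    simp only [Finset.coe_filter, Finset.mem_univ, true_and, Set.mem_ofPred_eq] at hx
    simp only [Finset.coe_Ico, Set.mem_Ico]
    omega
  · exact fun x _ y _ h => Fin.ext h
  · rw [Nat.card_Ico]; omega

theorem sum_crossing_le (k N : ℕ) {U : Matrix (Fin (2 * m)) (Fin (2 * m)) ℂ} (hU : U * Uᴴ = 1) :
    (∑ x, ∑ y, if (x ∈ firstModes m k ↔ y ∈ firstModes m k) then 0 else ‖U x y‖ ^ 2) ≤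
      2 * N + farTransport k N U := by
  have h1 : ∀ x y : Fin (2 * m), (if (x ∈ firstModes m k ↔ y ∈ firstModes m k) then 0
      else ‖U x y‖ ^ 2) ≤ (if (x : ℕ) < k + N ∧ k < x + N then ‖U x y‖ ^ 2 else 0) +
        if ((x : ℕ) < k ↔ (y : ℕ) < k) ∨ ((x : ℕ) < y + N ∧ (y : ℕ) < x + N) then 0
          else ‖U x y‖ ^ 2 := by
    intro x y
    have hn := sq_nonneg ‖U x y‖
    simp only [firstModes, Finset.mem_filter, Finset.mem_univ, true_and]
    -- If x is at distance at least N from the cut, every y on the other side is at distance at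
    -- least N from x.
    split_ifs with a b c d <;> first | linarith | (exfalso; omega)
  refine (Finset.sum_le_sum fun x _ => Finset.sum_le_sum fun y _ => h1 x y).trans ?_
  simp_rw [Finset.sum_add_distrib]
  have h2 : (∑ x : Fin (2 * m), ∑ y : Fin (2 * m),
      if (x : ℕ) < k + N ∧ k < x + N then ‖U x y‖ ^ 2 else 0) ≤ 2 * N := by
    have h3 : ∀ x : Fin (2 * m), (∑ y : Fin (2 * m),
        if (x : ℕ) < k + N ∧ k < x + N then ‖U x y‖ ^ 2 else 0) =
        if (x : ℕ) < k + N ∧ k < x + N then (1 : ℝ) else 0 := by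
      intro x
      split_ifs
      · exact sum_norm_sq_row hU x
      · simp
    simp_rw [h3]
    rw [← Finset.sum_filter, Finset.sum_const, nsmul_eq_mul, mul_one]
    exact_mod_cast card_filter_near_le (2 * m) k N
  have h4 : (∑ x : Fin (2 * m), ∑ y : Fin (2 * m),
      if ((x : ℕ) < k ↔ (y : ℕ) < k) ∨ ((x : ℕ) < y + N ∧ (y : ℕ) < x + N) then 0
          else ‖U x y‖ ^ 2) = farTransport k N U := Finset.sum_comm
  rw [h4]
  linarith

/-- The centre of the block of x is at distance 1/2 from x, hence N - 1/2 in place of N. -/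
theorem cosh_le_leftWeight (l : ℝ) {N : ℕ} (hN : 1 ≤ N) (x y : Fin (2 * m))
    (h : ¬ ((x : ℕ) < y + N ∧ (y : ℕ) < x + N)) :
    Real.cosh (l * (N - 1 / 2)) ≤ leftWeight l y x := by
  have hN' : (1 : ℝ) ≤ N := by exact_mod_cast hN
  unfold leftWeight
  rw [Real.cosh_le_cosh, abs_mul, abs_mul]
  refine mul_le_mul_of_nonneg_left ?_ (abs_nonneg _)
  rw [abs_of_nonneg (show (0 : ℝ) ≤ N - 1 / 2 by linarith)]
  have e1 : (2 * (((x : ℕ) / 2 : ℕ) : ℝ)) ≤ ((x : ℕ) : ℝ) := by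
    have : 2 * ((x : ℕ) / 2) ≤ x := by omega
    exact_mod_cast this
  have e2 : ((x : ℕ) : ℝ) ≤ 2 * (((x : ℕ) / 2 : ℕ) : ℝ) + 1 := by
    have : (x : ℕ) ≤ 2 * ((x : ℕ) / 2) + 1 := by omega
    exact_mod_cast this
  rcases not_and_or.mp h with h | h
  · have : ((y : ℕ) : ℝ) + N ≤ ((x : ℕ) : ℝ) := by exact_mod_cast not_lt.mp h
    refine le_trans ?_ (le_abs_self _)
    linarith
  · have : ((x : ℕ) : ℝ) + N ≤ ((y : ℕ) : ℝ) := by exact_mod_cast not_lt.mp h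
    refine le_trans ?_ (neg_le_abs _)
    linarith

theorem leftWeight_self (l : ℝ) (y : Fin (2 * m)) : leftWeight l y y = Real.cosh (l / 2) := by
  unfold leftWeight
  obtain ⟨j, hj | hj⟩ : ∃ j, (y : ℕ) = 2 * j ∨ (y : ℕ) = 2 * j + 1 := ⟨(y : ℕ) / 2, by omega⟩
  · rw [hj, show 2 * j / 2 = j by omega]
    congr 1
    push_cast
    ring
  · rw [hj, show (2 * j + 1) / 2 = j by omega, ← Real.cosh_neg]
    congr 1
    push_cast
    ring

/-- A Chernoff bound for the random walk started at y: initial weight cosh(l/2), growth cosh² l per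
step, and weight at least cosh(l(N - 1/2)) wherever the far column is supported. -/
theorem lintegral_farColumn_le {d : ℕ} (l : ℝ) {N : ℕ} (hN : 1 ≤ N) (k : ℕ)
    (y : Fin (2 * m)) :
    ∫⁻ g, ENNReal.ofReal (farColumn k N (brickwall g) y) ∂(haarCircuit m d) ≤
      ENNReal.ofReal ((Real.cosh l ^ 2) ^ d * Real.cosh (l / 2) / Real.cosh (l * (N - 1 / 2))) := by
  have hw : ∀ x, 0 ≤ leftWeight l y x := fun x => (Real.cosh_pos _).le
  have hC : 0 < Real.cosh (l * (N - 1 / 2)) := Real.cosh_pos _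
  have h1 : ∀ g : CircuitGates m d, ENNReal.ofReal (farColumn k N (brickwall g) y) ≤
      ENNReal.ofReal (Real.cosh (l * (N - 1 / 2)))⁻¹ *
        energy (leftWeight l y) (brickwall g *ᵥ Pi.single y 1) := by
    intro g
    rw [energy_eq_ofReal hw, ← ENNReal.ofReal_mul (inv_nonneg.mpr hC.le)]
    refine ENNReal.ofReal_le_ofReal ?_
    rw [Finset.mul_sum, farColumn]
    refine Finset.sum_le_sum fun x _ => ?_
    rw [mulVec_single_one, col_apply]
    split_ifs with h
    · exact mul_nonneg (inv_nonneg.mpr hC.le) (mul_nonneg (hw x) (sq_nonneg _))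
    · rw [← mul_assoc]
      refine le_mul_of_one_le_left (sq_nonneg _) ?_
      rw [inv_mul_eq_div, one_le_div hC]
      exact cosh_le_leftWeight l hN x y (fun h' => h (Or.inr h'))
  have hm : Measurable fun g : CircuitGates m d =>
      energy (leftWeight l y) (brickwall g *ᵥ Pi.single y 1) :=
    measurable_energy _ (measurable_mulVec_apply (M := fun g : CircuitGates m d => brickwall g)
      (v := fun _ => Pi.single y 1) measurable_brickwall_apply fun _ => measurable_const)
  refine (lintegral_mono h1).trans ?_
  rw [lintegral_const_mul _ hm]
  have h2 : energy (leftWeight l y) (Pi.single y 1) = ENNReal.ofReal (Real.cosh (l / 2)) := by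
    rw [energy_eq_ofReal hw, Finset.sum_eq_single y (fun x _ hx => by simp [hx]) (by simp),
      leftWeight_self]
    simp
  have h3 := lintegral_energy_brickwall_le (d := d) l y (Pi.single y 1)
  rw [h2, ← ENNReal.ofReal_pow (by positivity), ← ENNReal.ofReal_mul (by positivity)] at h3
  refine (mul_le_mul_right h3 _).trans (le_of_eq ?_)
  rw [← ENNReal.ofReal_mul (inv_nonneg.mpr hC.le)]
  congr 1
  field_simp

theorem card_filter_lightCone_le (n k d : ℕ) :
    (Finset.univ.filter fun y : Fin n => k ≤ (y : ℕ) + 2 * d ∧ (y : ℕ) < k + 2 * d).card ≤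
      4 * d := by
  refine le_trans (Finset.card_le_card_of_injOn (fun x : Fin n => (x : ℕ))
    (t := Finset.Ico (k - 2 * d) (k + 2 * d)) ?_ ?_) ?_
  · intro x hx
    simp only [Finset.coe_filter, Finset.mem_univ, true_and, Set.mem_ofPred_eq] at hx
    simp only [Finset.coe_Ico, Set.mem_Ico]
    omega
  · exact fun x _ y _ h => Fin.ext h
  · rw [Nat.card_Ico]; omega

theorem measurable_farColumn {d : ℕ} (k N : ℕ) (y : Fin (2 * m)) :
    Measurable fun g : CircuitGates m d => farColumn k N (brickwall g) y := by
  unfold farColumn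
  refine Finset.measurable_sum _ fun x _ => ?_
  split_ifs
  · exact measurable_const
  · exact (measurable_brickwall_apply x y).norm.pow_const 2

theorem lintegral_farTransport_le {d : ℕ} (l : ℝ) {N : ℕ} (hN : 1 ≤ N) (k : ℕ) :
    ∫⁻ g, ENNReal.ofReal (farTransport k N (brickwall g)) ∂(haarCircuit m d) ≤
      ENNReal.ofReal (4 * d *
        ((Real.cosh l ^ 2) ^ d * Real.cosh (l / 2) / Real.cosh (l * (N - 1 / 2)))) := by
  set B := (Real.cosh l ^ 2) ^ d * Real.cosh (l / 2) / Real.cosh (l * (N - 1 / 2)) with hB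
  have hB0 : 0 ≤ B := by
    have h1 := (Real.cosh_pos l).le
    have h2 := (Real.cosh_pos (l / 2)).le
    have h3 := (Real.cosh_pos (l * (N - 1 / 2))).le
    positivity
  unfold farTransport
  simp_rw [fun g : CircuitGates m d => ENNReal.ofReal_sum_of_nonneg
    (s := (Finset.univ : Finset (Fin (2 * m)))) fun y _ => farColumn_nonneg k N (brickwall g) y]
  rw [lintegral_finsetSum _ fun y _ => (measurable_farColumn k N y).ennreal_ofReal]
  -- Columns whose light cone misses the cut vanish, so at most 4d of them count and the bound does
  -- not depend on m.
  have h1 : ∀ y : Fin (2 * m), ∫⁻ g, ENNReal.ofReal (farColumn k N (brickwall g) y) ∂(haarCircuit m d) ≤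
      if k ≤ (y : ℕ) + 2 * d ∧ (y : ℕ) < k + 2 * d then ENNReal.ofReal B else 0 := by
    intro y
    split_ifs with h
    · exact lintegral_farColumn_le l hN k y
    · refine le_of_eq ?_
      have h0 : ∀ g : CircuitGates m d, farColumn k N (brickwall g) y = 0 := by
        intro g
        refine Finset.sum_eq_zero fun x _ => ?_
        split_ifs with hx
        · rfl
        · rw [brickwall_apply_eq_zero g x y (by omega)]; simp
      simp_rw [h0]
      simp
  refine (Finset.sum_le_sum fun y _ => h1 y).trans ?_
  rw [← Finset.sum_filter, Finset.sum_const, nsmul_eq_mul, ENNReal.ofReal_mul (by positivity)]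
  gcongr
  rw [show (4 * (d : ℝ)) = ((4 * d : ℕ) : ℝ) by push_cast; ring, ENNReal.ofReal_natCast]
  exact_mod_cast card_filter_lightCone_le (2 * m) k d

end

section

/-! ### The average-case bounds -/

variable {m : ℕ}

/-- At the diffusive scale, far transport is polynomially small in the depth. -/
theorem lintegral_farTransport_le_div_pow (κ : ℕ) {d : ℕ} (hd : 2 ≤ d) (k : ℕ) :
    ∫⁻ g, ENNReal.ofReal (farTransport k
      ⌈((κ : ℝ) + 2) * Real.sqrt ((d : ℝ) * Real.log (d : ℝ))⌉₊ (brickwall g)) ∂(haarCircuit m d) ≤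
      ENNReal.ofReal (72 / (d : ℝ) ^ κ) := by
  have hd2 : (2 : ℝ) ≤ d := by exact_mod_cast hd
  have hd0 : (0 : ℝ) < d := by linarith
  have hlog : 0 < Real.log d := Real.log_pos (by linarith)
  have hr : 0 < Real.sqrt ((d : ℝ) * Real.log d) := Real.sqrt_pos.mpr (by positivity)
  set r := Real.sqrt ((d : ℝ) * Real.log d) with hrdef
  set N := ⌈((κ : ℝ) + 2) * r⌉₊ with hN
  have hN1 : 1 ≤ N := Nat.one_le_ceil_iff.mpr (by positivity)
  have hNr : ((κ : ℝ) + 2) * r ≤ N := Nat.le_ceil _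
  -- Chosen so that l²d = log d and l√(d log d) = log d: the growth over d steps is at most d, while
  -- the weight at distance N is of order at least d^(κ+2).
  set l := Real.sqrt (Real.log d / d) with hl
  have hl0 : 0 ≤ l := Real.sqrt_nonneg _
  have hlsq : l ^ 2 = Real.log d / d := Real.sq_sqrt (by positivity)
  have hl1 : l ≤ 1 := by
    refine Real.sqrt_le_one.mpr ?_
    rw [div_le_one hd0]
    exact (Real.log_le_sub_one_of_pos hd0).trans (by linarith)
  have hlr : l * r = Real.log d := by
    rw [hl, hrdef, ← Real.sqrt_mul (by positivity)]
    rw [show Real.log d / d * (d * Real.log d) = Real.log d ^ 2 by field_simp]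
    exact Real.sqrt_sq hlog.le
  refine (lintegral_farTransport_le l hN1 k).trans (ENNReal.ofReal_le_ofReal ?_)
  have hexp1 : Real.exp 1 ≤ 3 := by linarith [Real.exp_one_lt_d9]
  have h1 : (Real.cosh l ^ 2) ^ d ≤ d := by
    have h := Real.cosh_le_exp_half_sq l
    calc (Real.cosh l ^ 2) ^ d ≤ (Real.exp (l ^ 2 / 2) ^ 2) ^ d := by
          have := (Real.cosh_pos l).le
          gcongr
      _ = Real.exp (Real.log d) := by
          rw [← Real.exp_nat_mul, ← Real.exp_nat_mul, hlsq]
          congr 1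
          push_cast
          field_simp
      _ = d := Real.exp_log hd0
  have h2 : Real.cosh (l / 2) ≤ 3 := by
    refine (Real.cosh_le_exp_half_sq _).trans (le_trans (Real.exp_le_exp.mpr ?_) hexp1)
    nlinarith
  -- The 6 is 2 · 3: cosh x ≥ eˣ/2, and the shift by 1/2 costs at most a factor e ≤ 3.
  have h3 : (d : ℝ) ^ (κ + 2) / 6 ≤ Real.cosh (l * (N - 1 / 2)) := by
    have e1 : ((κ : ℝ) + 2) * Real.log d - 1 ≤ l * (N - 1 / 2) := by
      have := mul_le_mul_of_nonneg_left hNr hl0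
      nlinarith
    have e2 : Real.exp (l * (N - 1 / 2)) / 2 ≤ Real.cosh (l * (N - 1 / 2)) := by
      rw [Real.cosh_eq]
      have := Real.exp_pos (-(l * (N - 1 / 2)))
      linarith
    have e3 : (d : ℝ) ^ (κ + 2) = Real.exp (((κ : ℝ) + 2) * Real.log d) := by
      rw [show ((κ : ℝ) + 2) = ((κ + 2 : ℕ) : ℝ) by push_cast; ring, Real.exp_nat_mul,
        Real.exp_log hd0]
    have e4 : Real.exp (((κ : ℝ) + 2) * Real.log d) / 3 ≤ Real.exp (l * (N - 1 / 2)) := by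
      refine le_trans ?_ (Real.exp_le_exp.mpr e1)
      rw [Real.exp_sub]
      have := Real.exp_pos 1
      gcongr
    rw [e3]
    linarith
  have hpow : 0 < (d : ℝ) ^ (κ + 2) / 6 := by positivity
  have hcosh := (Real.cosh_pos (l / 2)).le
  -- The constant is 72 = 4 · 3 · 6; the two surplus powers of d absorb the column count and the
  -- growth.
  calc 4 * d * ((Real.cosh l ^ 2) ^ d * Real.cosh (l / 2) / Real.cosh (l * (N - 1 / 2)))
      ≤ 4 * d * (d * 3 / ((d : ℝ) ^ (κ + 2) / 6)) := by gcongr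
    _ = 72 / (d : ℝ) ^ κ := by
        rw [pow_add]
        field_simp
        norm_num

theorem one_le_sqrt_mul_log {d : ℕ} (hd : 2 ≤ d) :
    1 ≤ Real.sqrt ((d : ℝ) * Real.log (d : ℝ)) := by
  rw [Real.one_le_sqrt]
  have hd2 : (2 : ℝ) ≤ d := by exact_mod_cast hd
  have h1 : Real.log 2 ≤ Real.log d := Real.log_le_log (by norm_num) hd2
  have h2 := Real.log_two_gt_d9
  nlinarith

/-- With r = √(d log d) ≥ 1, the near part is 2N ≤ 2((κ + 2)r + 1) ≤ (2κ + 6)r. -/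
theorem entropy_le_farTransport {d : ℕ} (κ k : ℕ) (hd : 2 ≤ d) {s : ℝ} (hs : 0 < s)
    (g : CircuitGates m d) :
    entropy s k g ≤ Real.sinh (2 * s) ^ 2 *
      ((2 * κ + 6) * Real.sqrt ((d : ℝ) * Real.log (d : ℝ)) +
        farTransport k ⌈((κ : ℝ) + 2) * Real.sqrt ((d : ℝ) * Real.log (d : ℝ))⌉₊ (brickwall g)) := by
  have hU := brickwall_unitary g
  refine (renyi2_le_sum_norm_sq hs _ hU).trans (mul_le_mul_of_nonneg_left ?_ (sq_nonneg _))
  refine (sum_crossing_le k ⌈((κ : ℝ) + 2) * Real.sqrt ((d : ℝ) * Real.log (d : ℝ))⌉₊ hU).trans ?_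
  have h1 := one_le_sqrt_mul_log hd
  have h2 := (Nat.ceil_lt_add_one (show 0 ≤ ((κ : ℝ) + 2) * Real.sqrt ((d : ℝ) * Real.log (d : ℝ))
    by positivity)).le
  linarith

theorem measurable_farTransport {d : ℕ} (k N : ℕ) :
    Measurable fun g : CircuitGates m d => farTransport k N (brickwall g) :=
  Finset.measurable_sum _ fun y _ => measurable_farColumn k N y

theorem farTransport_nonneg (k N : ℕ) (U : Matrix (Fin (2 * m)) (Fin (2 * m)) ℂ) :
    0 ≤ farTransport k N U := Finset.sum_nonneg fun y _ => farColumn_nonneg k N U y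

theorem integrable_entropy (m d k : ℕ) {s : ℝ} (hs : 0 < s) :
    Integrable (fun g : CircuitGates m d => entropy s k g) (haarCircuit m d) := by
  -- The worst-case bound is uniform in the gates, so on a probability space it gives integrability.
  refine Integrable.of_bound (measurable_entropy m d k s).aestronglyMeasurable
    (4 * (d : ℝ) * Real.log (Real.cosh (2 * s))) (Filter.Eventually.of_forall fun g => ?_)
  rw [Real.norm_of_nonneg (entropy_nonneg k hs g)]
  exact entropy_le_depth k hs g

theorem integral_entropy_le (m k : ℕ) {d : ℕ} (hd : 2 ≤ d) {s : ℝ} (hs : 0 < s) :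
    ∫ g : CircuitGates m d, entropy s k g ∂(haarCircuit m d) ≤
      78 * Real.sqrt ((d : ℝ) * Real.log (d : ℝ)) * Real.sinh (2 * s) ^ 2 := by
  set r := Real.sqrt ((d : ℝ) * Real.log (d : ℝ)) with hr
  have hr1 : 1 ≤ r := one_le_sqrt_mul_log hd
  set S := Real.sinh (2 * s) ^ 2 with hS
  have hS0 : 0 ≤ S := sq_nonneg _
  rw [integral_eq_lintegral_of_nonneg_ae (Filter.Eventually.of_forall fun g => entropy_nonneg k hs g)
    (measurable_entropy m d k s).aestronglyMeasurable]
  refine ENNReal.toReal_le_of_le_ofReal (by positivity) ?_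
  have h1 : ∀ g : CircuitGates m d, ENNReal.ofReal (entropy s k g) ≤
      ENNReal.ofReal (S * (6 * r)) + ENNReal.ofReal S *
        ENNReal.ofReal (farTransport k ⌈((0 : ℕ) + 2) * r⌉₊ (brickwall g)) := by
    intro g
    have hf := farTransport_nonneg k ⌈(((0 : ℕ) : ℝ) + 2) * r⌉₊ (brickwall g)
    rw [← ENNReal.ofReal_mul hS0, ← ENNReal.ofReal_add (by positivity) (by positivity), ← mul_add]
    refine ENNReal.ofReal_le_ofReal ?_
    have := entropy_le_farTransport 0 k hd hs g
    rwa [← hr, ← hS, show 2 * ((0 : ℕ) : ℝ) + 6 = 6 by norm_num] at this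
  refine (lintegral_mono h1).trans ?_
  rw [lintegral_add_left measurable_const, lintegral_const, measure_univ, mul_one,
    lintegral_const_mul _ (measurable_farTransport k _).ennreal_ofReal]
  -- For the mean, κ = 0 suffices: 6r + 72 ≤ 78r.
  have h2 := lintegral_farTransport_le_div_pow (m := m) 0 hd k
  rw [pow_zero, div_one] at h2
  calc _ ≤ ENNReal.ofReal (S * (6 * r)) + ENNReal.ofReal S * ENNReal.ofReal 72 := by gcongr
    _ = ENNReal.ofReal (S * (6 * r) + S * 72) := by
        rw [← ENNReal.ofReal_mul hS0, ← ENNReal.ofReal_add (by positivity) (by positivity)]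
    _ ≤ ENNReal.ofReal (78 * r * S) := by
        refine ENNReal.ofReal_le_ofReal ?_
        nlinarith

theorem le_measureReal_entropy_le (κ m k : ℕ) {d : ℕ} (hd : 2 ≤ d) {s : ℝ} (hs : 0 < s) :
    1 - 72 / (d : ℝ) ^ κ ≤ (haarCircuit m d).real {g : CircuitGates m d | entropy s k g ≤
      (2 * κ + 7) * Real.sinh (2 * s) ^ 2 * Real.sqrt ((d : ℝ) * Real.log (d : ℝ))} := by
  have hbound := entropy_le_farTransport (m := m) κ k hd hs
  have hr1 := one_le_sqrt_mul_log hd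
  have h2 := lintegral_farTransport_le_div_pow (m := m) κ hd k
  set r := Real.sqrt ((d : ℝ) * Real.log (d : ℝ)) with hr
  set S := Real.sinh (2 * s) ^ 2 with hS
  have hS0 : 0 ≤ S := sq_nonneg _
  set N := ⌈((κ : ℝ) + 2) * r⌉₊ with hN
  set E := {g : CircuitGates m d | entropy s k g ≤ (2 * κ + 7) * S * r} with hE
  have hEm : MeasurableSet E := measurableSet_le (measurable_entropy m d k s) measurable_const
  -- If the far transport is below 1 ≤ r, it fits into the gap between 2κ + 6 and 2κ + 7; Markov's
  -- inequality at level 1 handles the rest.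
  have hsub : Eᶜ ⊆ {g | 1 ≤ ENNReal.ofReal (farTransport k N (brickwall g))} := by
    intro g hg
    rw [Set.mem_compl_iff, hE, Set.mem_ofPred_eq, not_le] at hg
    rw [Set.mem_ofPred_eq, ENNReal.one_le_ofReal]
    by_contra! hlt
    have h3 := hbound g
    have h4 : S * ((2 * κ + 6) * r + farTransport k N (brickwall g)) ≤ S * ((2 * κ + 7) * r) :=
      mul_le_mul_of_nonneg_left (by linarith) hS0
    linarith
  have hmarkov : haarCircuit m d Eᶜ ≤ ENNReal.ofReal (72 / (d : ℝ) ^ κ) := by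
    refine (measure_mono hsub).trans (le_trans ?_ h2)
    have := mul_meas_ge_le_lintegral (μ := haarCircuit m d)
      (measurable_farTransport (m := m) (d := d) k N).ennreal_ofReal 1
    rwa [one_mul] at this
  have h5 : (haarCircuit m d).real Eᶜ ≤ 72 / (d : ℝ) ^ κ :=
    ENNReal.toReal_le_of_le_ofReal (by positivity) hmarkov
  rw [probReal_compl_eq_one_sub hEm] at h5
  linarith

end

end LinearOptics

end

open LinearOptics in
theorem theorem1 :
    -- worst-case bound
    (∀ (m d k : ℕ) (s : ℝ), 1 ≤ m → k ≤ 2 * m → 0 < s → ∀ g : CircuitGates m d,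
      entropy s k g ≤ 4 * (d : ℝ) * Real.log (Real.cosh (2 * s))) ∧
    -- average-case bound in expectation
    (∃ C : ℝ, ∀ (m d k : ℕ) (s : ℝ), 1 ≤ m → 2 ≤ d → k ≤ 2 * m → 0 < s →
      MeasureTheory.Integrable (fun g : CircuitGates m d => entropy s k g) (haarCircuit m d) ∧
      ∫ g : CircuitGates m d, entropy s k g ∂(haarCircuit m d) ≤
        C * Real.sqrt ((d : ℝ) * Real.log (d : ℝ)) * Real.sinh (2 * s) ^ 2) ∧
    -- average-case bound in probability
    (∀ κ : ℕ, ∃ C K : ℝ, ∀ (m d k : ℕ) (s : ℝ), 1 ≤ m → 2 ≤ d → k ≤ 2 * m → 0 < s →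
      1 - K / (d : ℝ) ^ κ ≤
        (haarCircuit m d).real {g : CircuitGates m d |
          entropy s k g ≤ C * Real.sinh (2 * s) ^ 2 * Real.sqrt ((d : ℝ) * Real.log (d : ℝ))}) := by
  refine ⟨fun m d k s _ _ hs g => entropy_le_depth k hs g, ⟨78, fun m d k s _ hd _ hs =>
    ⟨integrable_entropy m d k hs, integral_entropy_le m k hd hs⟩⟩, fun κ => ⟨2 * κ + 7, 72,
    fun m d k s _ hd _ hs => le_measureReal_entropy_le κ m k hd hs⟩⟩
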